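/- Conventions: graphs are finite and simple, natural numbers include $0$, and "contains" means as a (not necessarily induced) subgraph. A graph is $d$-degenerate if each of its subgraphs with at least one vertex has a vertex of degree at most $d$ in that subgraph. The Ramsey number $r(H)$ of a graph $H$ is the least integer $m$ such that every 2-coloring of the edges of the complete graph on $m$ vertices has a monochromatic copy of $H$. Theorem. There exists an absolute constant $c$ such that the following holds for all natural numbers $d$, $r$ and $n$ satisfying $n \ge 2^{d^2 2^{cr}}$. For every 2-coloring of the edges of a complete graph on at least $2^{d 2^{cr}} n$ vertices, there is one of the two colors such that the graph formed by all edges of that color contains every $d$-degenerate $r$-colorable graph on at most $n$ vertices. Moreover, every $d$-degenerate graph is $(d+1)$-colorable, and the conjecture of Burr and Erdős holds: for every natural number $d$ there is a constant $C = C(d)$ such that every $d$-degenerate graph $H$ on $n$ vertices satisfies $r(H) \le C n$. -/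

import Mathlib

universe u v

namespace BurrErdos

/-- `H` is `d`-degenerate: every subgraph of `H` (having at least one vertex) has a vertex whose
degree in that subgraph is at most `d`. -/
def IsDegenerate {W : Type u} (H : SimpleGraph W) (d : ℕ) : Prop :=
  ∀ S : H.Subgraph, S.verts.Nonempty → ∃ v ∈ S.verts, (S.neighborSet v).encard ≤ d

/-- The family of (finite) `d`-degenerate `r`-colorable graphs on at most `n` vertices. -/
def DegenerateColorable (d r n : ℕ) (W : Type u) (H : SimpleGraph W) : Prop :=
  Finite W ∧ Nat.card W ≤ n ∧ IsDegenerate H d ∧ H.Colorable r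

/-- `G` is universal for the family `F`: it contains every member of `F` as a subgraph (not
necessarily an induced one). -/
def IsUniversal {V : Type v} (G : SimpleGraph V) (F : (W : Type u) → SimpleGraph W → Prop) :
    Prop :=
  ∀ (W : Type u) (H : SimpleGraph W), F W H → H.IsContained G

/-- The Ramsey number of `H`: the least `m` such that every edge two-coloring of the complete
graph on `m` vertices has a monochromatic copy of `H` (and `⊤` if there is no such `m`). -/
noncomputable def ramseyNumber {W : Type u} (H : SimpleGraph W) : ℕ∞ :=
  sInf {N : ℕ∞ | ∃ m : ℕ, N = m ∧
    ∀ χ : SimpleGraph.TopEdgeLabeling (Fin m) (Fin 2),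
      ∃ k : Fin 2, H.IsContained (χ.labelGraph k)}

end BurrErdos

/-!
The proof embeds a `d`-degenerate graph vertex by vertex, in an order in which every vertex has at
most `d` back neighbors, and chooses each image uniformly at random among the unused candidates,
that is, the common neighbors of the images of the back neighbors in a prescribed class. Some
candidate sets may be much smaller than a linear proportion of their class; it suffices to control
the *negative moments* of their sizes.

* **Rich classes.** Let `D = 2 * d`. In one of the two colors there are many cliques
  (`card_pow_le_cliqueCount`). Averaging over the complete `r`-partite systems `Y` of `2 * D`-tuples,
  with the common neighborhood of all `Y a`, `a ≠ e`, as class `e`, dependent random choice gives a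
  system of classes in which the `(-2 * D)`-th moment of the number of common neighbors in one
  class, over uniformly random tuples of at most `D` vertices of the other classes, is bounded
  (`sum_momentSum_le`, `exists_isRich`). No tuple has to be discarded, since a tuple with `m` common
  neighbors arises from only `m ^ (2 * D)` choices of `Y e`.

* **Moments along the embedding.** Let `c v` be the density of the candidate set of the vertex `v` in
  its class. The images of the back neighbors `u` of `v` have a joint distribution with density at
  most `∏ 2 / c u`, so the expectation of `c v ^ (-2 * D) * ∏ c u` is bounded by the moment for
  uniform tuples (`IsRich.expect_weighted_le`). The inequality
  `c v ^ (-D) ≤ (c v ^ (-2 * D) * ∏ c u + ∏ (c u)⁻¹) / 2` and the inequality between the arithmetic and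
  the geometric mean turn this into a bound for the expectation of `c v ^ (-D)` that is the same for
  all `v` (`IsRich.expect_inv_density_pow_le`).

* **Injectivity.** The first negative moments sum to a small number, which makes a set `S` that is
  not tiny receive at most `#S / 2` images, except with probability exponentially small in `#S`
  (`expect_exp_count_le`). As candidate sets are common neighborhoods of at most `D` vertices, there
  are only polynomially many of them, and the moment bound for `D ≥ 2` shows that none of them is
  tiny. So some outcome of the process is an embedding (`IsRich.exists_embedding`).

This needs `2 ^ (320 * r ^ 2 * d) * n` vertices and no lower bound on `n`
(`exists_isUniversal_labelGraph`).
-/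

open Finset

namespace BurrErdos

/-! ### Expectations over a random sequential process -/

section RandomProcess

variable {V : Type v}

/-- One step of the random process: the value at `j` is replaced by a uniformly random element of
the set `T j φ` of candidates, and `F` is averaged over it. -/
noncomputable def stepAvg (T : ℕ → (ℕ → V) → Finset V) (j : ℕ) (F : (ℕ → V) → ℝ) (φ : ℕ → V) : ℝ :=
  (∑ x ∈ T j φ, F (Function.update φ j x)) / #(T j φ)

/-- The expectation of `F φ`, where `φ` arises from `φ₀` by redefining the values at
`0, …, j - 1` in this order, each time uniformly at random from the current candidates. -/
noncomputable def expect (T : ℕ → (ℕ → V) → Finset V) (φ₀ : ℕ → V) : ℕ → ((ℕ → V) → ℝ) → ℝ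
  | 0, F => F φ₀
  | j + 1, F => expect T φ₀ j (stepAvg T j F)

variable {T : ℕ → (ℕ → V) → Finset V} {φ₀ : ℕ → V}

theorem stepAvg_eq_self (hT : ∀ j φ, (T j φ).Nonempty) {j : ℕ} {F : (ℕ → V) → ℝ} {φ : ℕ → V}
    (h : ∀ x, F (Function.update φ j x) = F φ) : stepAvg T j F φ = F φ := by
  have : (#(T j φ) : ℝ) ≠ 0 := by simpa using (hT j φ).ne_empty
  simp only [stepAvg, h, sum_const, nsmul_eq_mul]
  field_simp

theorem expect_mono {P : (ℕ → V) → Prop} (hP : P φ₀)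
    (hPT : ∀ j φ, P φ → ∀ x ∈ T j φ, P (Function.update φ j x)) {F F' : (ℕ → V) → ℝ}
    (h : ∀ φ, P φ → F φ ≤ F' φ) (j : ℕ) : expect T φ₀ j F ≤ expect T φ₀ j F' := by
  induction j generalizing F F' with
  | zero => exact h _ hP
  | succ j ih =>
    refine ih fun φ hφ => ?_
    unfold stepAvg
    gcongr with x hx
    exact h _ (hPT j φ hφ x hx)

theorem expect_add (F F' : (ℕ → V) → ℝ) (j : ℕ) :
    expect T φ₀ j (fun φ => F φ + F' φ) = expect T φ₀ j F + expect T φ₀ j F' := by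
  induction j generalizing F F' with
  | zero => rfl
  | succ j ih =>
    simp only [expect]
    rw [← ih]
    congr 1
    ext φ
    simp only [stepAvg, sum_add_distrib, add_div]

theorem expect_mul_left (c : ℝ) (F : (ℕ → V) → ℝ) (j : ℕ) :
    expect T φ₀ j (fun φ => c * F φ) = c * expect T φ₀ j F := by
  induction j generalizing F with
  | zero => rfl
  | succ j ih =>
    simp only [expect]
    rw [← ih]
    congr 1
    ext φ
    simp only [stepAvg, ← mul_sum, mul_div_assoc]

theorem expect_const (hT : ∀ j φ, (T j φ).Nonempty) (c : ℝ) (j : ℕ) :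
    expect T φ₀ j (fun _ => c) = c := by
  induction j with
  | zero => rfl
  | succ j ih =>
    simp only [expect]
    rw [show stepAvg T j (fun _ => c) = fun _ => c from
      funext fun φ => stepAvg_eq_self (F := fun _ => c) hT fun _ => rfl, ih]

theorem expect_sum (hT : ∀ j φ, (T j φ).Nonempty) {ι : Type*} (s : Finset ι)
    (F : ι → (ℕ → V) → ℝ) (j : ℕ) :
    expect T φ₀ j (fun φ => ∑ i ∈ s, F i φ) = ∑ i ∈ s, expect T φ₀ j (F i) := by
  classical
  induction s using Finset.induction_on with
  | empty => simpa using expect_const hT 0 j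
  | insert a s ha ih => simp only [sum_insert ha, expect_add, ih]

/-- Some outcome of the random process does at least as well as the average. -/
theorem exists_le_expect (hT : ∀ j φ, (T j φ).Nonempty)
    (hloc : ∀ i j φ x, i ≤ j → T i (Function.update φ j x) = T i φ) (F : (ℕ → V) → ℝ) (n : ℕ) :
    ∃ φ, F φ ≤ expect T φ₀ n F ∧ ∀ j < n, φ j ∈ T j φ := by
  induction n generalizing F with
  | zero => exact ⟨φ₀, le_rfl, by simp⟩
  | succ n ih =>
    obtain ⟨φ, hφ, hmem⟩ := ih (stepAvg T n F)
    obtain ⟨x, hx, hle⟩ : ∃ x ∈ T n φ, F (Function.update φ n x) ≤ stepAvg T n F φ := by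
      refine exists_le_of_sum_le (hT n φ) ?_
      have : (#(T n φ) : ℝ) ≠ 0 := by simpa using (hT n φ).ne_empty
      rw [sum_const, nsmul_eq_mul, stepAvg]
      field_simp
      rfl
    refine ⟨Function.update φ n x, hle.trans hφ, fun j hj => ?_⟩
    rw [hloc j n φ x (by omega)]
    rcases eq_or_ne j n with rfl | hne
    · simpa using hx
    · simpa [hne] using hmem j (by omega)

end RandomProcess

/-! ### The random greedy embedding -/

open Classical in
/-- The vertices of `S` that are adjacent to all vertices of `K`. -/
noncomputable def commonIn {V : Type v} (G : SimpleGraph V) (S K : Finset V) : Finset V :=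
  S.filter fun y => ∀ x ∈ K, G.Adj x y

open Classical in
/-- The family `A` of vertex classes is `(D, ρ)`-rich in `G`: among the `N` vertices, each class
contains a proportion of at least `1 / ρ`, vertices from the other classes always have a common
neighbor in `A e`, and the sum of the `(-2 * D)`-th powers of the numbers of these common neighbors,
over the `k`-tuples with a prescribed class pattern `a`, is at most what `N ^ k` tuples with
`N / ρ` common neighbors each would give. -/
structure IsRich {V : Type v} [Fintype V] (G : SimpleGraph V) {R : Type*}
    (A : R → Finset V) (D : ℕ) (ρ : ℝ) : Prop where
  card_le : ∀ e, (Fintype.card V : ℝ) ≤ ρ * #(A e)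
  nonempty : ∀ (e : R) (K : Finset V), (∀ x ∈ K, ∃ a, a ≠ e ∧ x ∈ A a) →
    (commonIn G (A e) K).Nonempty
  moment : ∀ (e : R) (k : ℕ), k ≤ D → ∀ a : Fin k → R, (∀ i, a i ≠ e) →
    ∑ x ∈ Fintype.piFinset fun i => A (a i), (1 / (#(commonIn G (A e) (univ.image x)) : ℝ)) ^ (2 * D)
      ≤ ρ ^ (2 * D) * (Fintype.card V : ℝ) ^ k / (Fintype.card V : ℝ) ^ (2 * D)

section Greedy

variable {V : Type v} (G : SimpleGraph V) {R : Type*} (A : R → Finset V)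
  (B : ℕ → Finset ℕ) (χ : ℕ → R)

open Classical in
/-- The vertices of class `χ j` that are adjacent to the images of all back neighbors of `j`. -/
noncomputable def cand (j : ℕ) (φ : ℕ → V) : Finset V :=
  commonIn G (A (χ j)) ((B j).image φ)

open Classical in
/-- The set from which the image of `j` is drawn: the candidates not used so far. Should these make
up less than half of all candidates, the whole class serves as a dummy. -/
noncomputable def choices (j : ℕ) (φ : ℕ → V) : Finset V :=
  if #(cand G A B χ j φ) ≤ 2 * #(cand G A B χ j φ \ (range j).image φ) ∧
      (cand G A B χ j φ).Nonempty
  then cand G A B χ j φ \ (range j).image φ else A (χ j)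

/-- The proportion of candidates for the image of `j` in their class. -/
noncomputable def density (j : ℕ) (φ : ℕ → V) : ℝ := #(cand G A B χ j φ) / #(A (χ j))

variable {G A B χ}

theorem mem_commonIn {S K : Finset V} {y : V} :
    y ∈ commonIn G S K ↔ y ∈ S ∧ ∀ x ∈ K, G.Adj x y := by
  simp [commonIn]

theorem commonIn_subset {S K : Finset V} : commonIn G S K ⊆ S := by
  classical exact filter_subset _ _

theorem cand_subset (j : ℕ) (φ : ℕ → V) : cand G A B χ j φ ⊆ A (χ j) := commonIn_subset

open Classical in
theorem choices_subset (j : ℕ) (φ : ℕ → V) : choices G A B χ j φ ⊆ A (χ j) := by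
  unfold choices
  split_ifs
  · exact sdiff_subset.trans (cand_subset j φ)
  · exact Subset.rfl

theorem mem_class_update {φ : ℕ → V} (hφ : ∀ u, φ u ∈ A (χ u)) {j : ℕ} {x : V}
    (hx : x ∈ choices G A B χ j φ) (u : ℕ) : Function.update φ j x u ∈ A (χ u) := by
  rcases eq_or_ne u j with rfl | hne
  · simpa using choices_subset _ _ hx
  · simpa [hne] using hφ u

open Classical in
theorem choices_nonempty (hA : ∀ e, (A e).Nonempty) (j : ℕ) (φ : ℕ → V) :
    (choices G A B χ j φ).Nonempty := by
  unfold choices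
  split_ifs with h
  · have := h.2.card_pos
    exact card_pos.1 (by omega)
  · exact hA _

theorem card_cand_le (j : ℕ) (φ : ℕ → V) :
    #(cand G A B χ j φ) ≤ 2 * #(choices G A B χ j φ) := by
  unfold choices
  split_ifs with h
  · exact h.1
  · have := card_le_card (cand_subset (G := G) (A := A) (B := B) (χ := χ) j φ)
    omega

open Classical in
theorem cand_update (hB : ∀ j, ∀ u ∈ B j, u < j) {i j : ℕ} (hij : i ≤ j) (φ : ℕ → V) (x : V) :
    cand G A B χ i (Function.update φ j x) = cand G A B χ i φ := by
  unfold cand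
  congr 1
  refine image_congr fun u hu => ?_
  have := hB i u hu
  exact Function.update_of_ne (by omega) _ _

theorem choices_update (hB : ∀ j, ∀ u ∈ B j, u < j) {i j : ℕ} (hij : i ≤ j) (φ : ℕ → V) (x : V) :
    choices G A B χ i (Function.update φ j x) = choices G A B χ i φ := by
  classical
  have : (range i).image (Function.update φ j x) = (range i).image φ := by
    refine image_congr fun u hu => ?_
    have : u < i := by simpa using hu
    exact Function.update_of_ne (by omega) _ _
  unfold choices
  rw [cand_update hB hij, this]

theorem density_update (hB : ∀ j, ∀ u ∈ B j, u < j) {i j : ℕ} (hij : i ≤ j) (φ : ℕ → V) (x : V) :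
    density G A B χ i (Function.update φ j x) = density G A B χ i φ := by
  unfold density
  rw [cand_update hB hij]

theorem density_nonneg (j : ℕ) (φ : ℕ → V) : 0 ≤ density G A B χ j φ := by
  unfold density
  positivity

theorem density_le_one (j : ℕ) (φ : ℕ → V) : density G A B χ j φ ≤ 1 := by
  unfold density
  refine div_le_one_of_le₀ ?_ (by positivity)
  exact_mod_cast card_le_card (cand_subset (G := G) (A := A) (B := B) (χ := χ) j φ)

open Classical in
/-- Under the random process, the joint distribution of the images of the vertices in `K` has
density at most `∏ 2 / density` with respect to the uniform distribution on tuples. -/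
theorem expect_prod_ite_le (hA : ∀ e, (A e).Nonempty) (hB : ∀ j, ∀ u ∈ B j, u < j) (φ₀ : ℕ → V)
    (K : Finset ℕ) (x : ℕ → V) (j : ℕ) :
    expect (choices G A B χ) φ₀ j
        (fun φ => ∏ u ∈ K with u < j, if φ u = x u then density G A B χ u φ else 0)
      ≤ ∏ u ∈ K with u < j, (2 / (#(A (χ u)) : ℝ)) := by
  induction j with
  | zero => simp [expect]
  | succ j ih =>
    have hinv : ∀ (φ : ℕ → V) (y : V),
        (∏ u ∈ K with u < j, if Function.update φ j y u = x u then
          density G A B χ u (Function.update φ j y) else 0)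
        = ∏ u ∈ K with u < j, if φ u = x u then density G A B χ u φ else 0 := by
      intro φ y
      refine prod_congr rfl fun u hu => ?_
      have hu : u < j := (mem_filter.1 hu).2
      rw [Function.update_of_ne (by omega), density_update hB hu.le]
    simp only [expect]
    by_cases hj : j ∈ K
    · have hK : K.filter (· < j + 1) = insert j (K.filter (· < j)) := by
        ext u
        simp only [mem_filter, mem_insert]
        constructor
        · rintro ⟨h1, h2⟩
          by_cases h : u = j
          · exact Or.inl h
          · exact Or.inr ⟨h1, by omega⟩
        · rintro (rfl | ⟨h1, h2⟩)
          · exact ⟨hj, by omega⟩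
          · exact ⟨h1, by omega⟩
      have hnot : j ∉ K.filter (· < j) := by simp
      rw [hK, prod_insert hnot]
      calc expect (choices G A B χ) φ₀ j (stepAvg (choices G A B χ) j fun φ =>
              ∏ u ∈ insert j (K.filter (· < j)), if φ u = x u then density G A B χ u φ else 0)
          ≤ expect (choices G A B χ) φ₀ j (fun φ => (2 / (#(A (χ j)) : ℝ)) *
              ∏ u ∈ K with u < j, if φ u = x u then density G A B χ u φ else 0) := by
            refine expect_mono (P := fun _ => True) trivial (fun _ _ _ _ _ => trivial)
              (fun φ _ => ?_) j
            have hprod : 0 ≤ ∏ u ∈ K with u < j, if φ u = x u then density G A B χ u φ else 0 :=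
              prod_nonneg fun u _ => by
                split_ifs
                · exact density_nonneg u φ
                · exact le_rfl
            simp only [stepAvg, prod_insert hnot, hinv, Function.update_self,
              density_update hB le_rfl]
            rw [← sum_mul, mul_div_right_comm]
            refine mul_le_mul_of_nonneg_right ?_ hprod
            have hT : (0 : ℝ) < #(choices G A B χ j φ) := by
              exact_mod_cast (choices_nonempty hA j φ).card_pos
            have hAj : (0 : ℝ) < #(A (χ j)) := by exact_mod_cast (hA (χ j)).card_pos
            have hc : (#(cand G A B χ j φ) : ℝ) ≤ 2 * #(choices G A B χ j φ) := by
              exact_mod_cast card_cand_le j φ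
            have hle : ∑ y ∈ choices G A B χ j φ, (if y = x j then density G A B χ j φ else 0)
                ≤ density G A B χ j φ := by
              rw [sum_ite_eq']
              split_ifs
              · exact le_rfl
              · exact density_nonneg j φ
            refine (div_le_div_of_nonneg_right hle hT.le).trans ?_
            unfold density
            rw [div_div, div_le_div_iff₀ (by positivity) hAj]
            nlinarith
        _ ≤ _ := by
            rw [expect_mul_left]
            exact mul_le_mul_of_nonneg_left ih (by positivity)
    · have hK : K.filter (· < j + 1) = K.filter (· < j) := by
        refine filter_congr fun u hu => ?_
        have : u ≠ j := fun h => hj (h ▸ hu)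
        omega
      rw [hK]
      refine le_trans (le_of_eq ?_) ih
      congr 1
      ext φ
      exact stepAvg_eq_self (F := fun φ => ∏ u ∈ K with u < j,
        if φ u = x u then density G A B χ u φ else 0) (choices_nonempty hA) (hinv φ)

/-- The process rarely puts many vertices into a set `S` that is not tiny: an exponential
supermartingale. -/
theorem expect_exp_count_le (hA : ∀ e, (A e).Nonempty) (hB : ∀ j, ∀ u ∈ B j, u < j)
    {φ₀ : ℕ → V} {P : (ℕ → V) → Prop} (hP : P φ₀)
    (hPT : ∀ j φ, P φ → ∀ x ∈ choices G A B χ j φ, P (Function.update φ j x))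
    (hne : ∀ φ, P φ → ∀ j, (cand G A B χ j φ).Nonempty) (S : Finset V) (j : ℕ) :
    expect (choices G A B χ) φ₀ j (fun φ => Real.exp
      (∑ i ∈ range j, (S : Set V).indicator (fun _ => (1 : ℝ)) (φ i)
        - 2 * #S * ∑ i ∈ range j, 2 / (#(cand G A B χ i φ) : ℝ))) ≤ 1 := by
  classical
  induction j with
  | zero => simp [expect]
  | succ j ih =>
    refine le_trans ?_ ih
    simp only [expect]
    refine expect_mono hP hPT (fun φ hφ => ?_) j
    have h1 : ∀ y, ∑ i ∈ range j, (S : Set V).indicator (fun _ => (1 : ℝ)) (Function.update φ j y i)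
        = ∑ i ∈ range j, (S : Set V).indicator (fun _ => (1 : ℝ)) (φ i) := by
      intro y
      refine sum_congr rfl fun i hi => ?_
      rw [Function.update_of_ne (by have := mem_range.1 hi; omega)]
    have h2 : ∀ y, ∑ i ∈ range j, 2 / (#(cand G A B χ i (Function.update φ j y)) : ℝ)
        = ∑ i ∈ range j, 2 / (#(cand G A B χ i φ) : ℝ) := by
      intro y
      refine sum_congr rfl fun i hi => ?_
      rw [cand_update hB (by have := mem_range.1 hi; omega)]
    set X := ∑ i ∈ range j, (S : Set V).indicator (fun _ => (1 : ℝ)) (φ i)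
    set Z := ∑ i ∈ range j, 2 / (#(cand G A B χ i φ) : ℝ)
    set T := choices G A B χ j φ with hTdef
    set b : ℝ := 2 / (#(cand G A B χ j φ) : ℝ)
    have hT : (0 : ℝ) < #T := by exact_mod_cast (choices_nonempty hA j φ).card_pos
    have hS : (0 : ℝ) < #(cand G A B χ j φ) := by exact_mod_cast (hne φ hφ j).card_pos
    have hc : (#(cand G A B χ j φ) : ℝ) ≤ 2 * #T := by exact_mod_cast card_cand_le j φ
    have hind : ∀ y, Real.exp ((S : Set V).indicator (fun _ => (1 : ℝ)) y)
        ≤ 1 + 2 * if y ∈ S then 1 else 0 := by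
      intro y
      by_cases hy : y ∈ S
      · have := Real.exp_one_lt_d9
        simp only [Set.indicator, mem_coe, hy, if_true]
        linarith
      · simp [hy]
    have hkey : ∑ y ∈ T, Real.exp ((S : Set V).indicator (fun _ => (1 : ℝ)) y)
        ≤ #T * Real.exp (2 * #S * b) := by
      calc _ ≤ ∑ y ∈ T, ((1 : ℝ) + 2 * if y ∈ S then 1 else 0) := sum_le_sum fun y _ => hind y
        _ = #T + 2 * #(T.filter (· ∈ S)) := by
            rw [sum_add_distrib, ← mul_sum, sum_boole]
            simp
        _ ≤ #T + 2 * #S := by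
            have : #(T.filter (· ∈ S)) ≤ #S := card_le_card fun y hy => (mem_filter.1 hy).2
            have : (#(T.filter (· ∈ S)) : ℝ) ≤ #S := by exact_mod_cast this
            linarith
        _ ≤ #T * (1 + 2 * #S * b) := by
            have : 1 ≤ #T * b := by
              simp only [b]
              rw [mul_div_assoc', le_div_iff₀ hS]
              linarith
            have : (#S : ℝ) * 1 ≤ #S * (#T * b) := by gcongr
            linarith
        _ ≤ _ := by
            gcongr
            linarith [Real.add_one_le_exp (2 * #S * b)]
    simp only [stepAvg, sum_range_succ, h1, h2, Function.update_self, cand_update hB le_rfl]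
    rw [div_le_iff₀ hT]
    calc _ = ∑ y ∈ T, Real.exp ((S : Set V).indicator (fun _ => (1 : ℝ)) y)
              * (Real.exp (X - 2 * #S * Z) * Real.exp (- (2 * #S * b))) := by
            refine sum_congr rfl fun y _ => ?_
            rw [← Real.exp_add, ← Real.exp_add]
            congr 1
            simp only [X, Z, b]
            ring
      _ ≤ #T * Real.exp (2 * #S * b) *
            (Real.exp (X - 2 * #S * Z) * Real.exp (- (2 * #S * b))) := by
            rw [← sum_mul]
            gcongr
      _ = _ := by
            rw [Real.exp_neg]
            field_simp

end Greedy

/-! ### Negative moments of the candidate densities -/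

/-- A consequence of the inequality between the arithmetic and the geometric mean. -/
theorem prod_le_sum_pow_div_card {ι : Type*} (s : Finset ι) (hs : s.Nonempty) (y : ι → ℝ)
    (hy : ∀ i ∈ s, 1 ≤ y i) {D : ℕ} (hD : #s ≤ D) :
    ∏ i ∈ s, y i ≤ (∑ i ∈ s, y i ^ D) / #s := by
  have hs0 : #s ≠ 0 := hs.card_pos.ne'
  have hs1 : (#s : ℝ) ≠ 0 := by exact_mod_cast hs0
  have h := Real.geom_mean_le_arith_mean_weighted s (fun _ => (#s : ℝ)⁻¹) (fun i => y i ^ #s)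
    (fun _ _ => by positivity) (by simp [hs1])
    (fun i hi => by have := hy i hi; positivity)
  have h1 : ∏ i ∈ s, (y i ^ #s) ^ ((#s : ℝ)⁻¹) = ∏ i ∈ s, y i :=
    prod_congr rfl fun i hi => Real.pow_rpow_inv_natCast (by linarith [hy i hi]) hs0
  rw [h1, ← mul_sum] at h
  refine h.trans ?_
  rw [div_eq_inv_mul]
  gcongr with i hi
  exact hy i hi

theorem one_div_pow_le_add_prod {ι : Type*} (s : Finset ι) (c : ι → ℝ) (hc : ∀ i ∈ s, 0 < c i)
    (p : ℝ) (D : ℕ) :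
    (1 / p) ^ D ≤ 2⁻¹ * ((1 / p) ^ (2 * D) * (∏ i ∈ s, c i) + ∏ i ∈ s, 1 / c i) := by
  have hX : 0 < ∏ i ∈ s, c i := prod_pos hc
  have hZ : ∏ i ∈ s, 1 / c i = (∏ i ∈ s, c i)⁻¹ := by simp
  rw [hZ, mul_comm 2 D, pow_mul]
  set q := (1 / p) ^ D
  set X := ∏ i ∈ s, c i
  have : q ^ 2 * X + X⁻¹ - 2 * q = X⁻¹ * (q * X - 1) ^ 2 := by
    field_simp
    ring
  have : 0 ≤ X⁻¹ * (q * X - 1) ^ 2 := by positivity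
  linarith

section Moments

variable {V : Type v} [Fintype V] {G : SimpleGraph V} {R : Type*} {A : R → Finset V}
  {B : ℕ → Finset ℕ} {χ : ℕ → R} {D : ℕ} {ρ : ℝ}

theorem IsRich.class_nonempty (h : IsRich G A D ρ) (e : R) : (A e).Nonempty :=
  (h.nonempty e ∅ (by simp)).mono commonIn_subset

theorem IsRich.card_pos (h : IsRich G A D ρ) (e : R) : (0 : ℝ) < Fintype.card V := by
  obtain ⟨x, -⟩ := h.class_nonempty e
  exact_mod_cast Fintype.card_pos_iff.2 ⟨x⟩

theorem IsRich.one_le (h : IsRich G A D ρ) (e : R) : 1 ≤ ρ := by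
  have h1 := h.card_le e
  have h2 : (#(A e) : ℝ) ≤ Fintype.card V := by exact_mod_cast card_le_univ _
  have h3 : (0 : ℝ) < #(A e) := by exact_mod_cast (h.class_nonempty e).card_pos
  by_contra hlt
  nlinarith

theorem IsRich.cand_nonempty (h : IsRich G A D ρ) (hχ : ∀ j, ∀ u ∈ B j, χ u ≠ χ j)
    {j : ℕ} {φ : ℕ → V} (hφ : ∀ u ∈ B j, φ u ∈ A (χ u)) : (cand G A B χ j φ).Nonempty := by
  refine h.nonempty _ _ fun x hx => ?_
  classical
  obtain ⟨u, hu, rfl⟩ := mem_image.1 hx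
  exact ⟨χ u, hχ j u hu, hφ u hu⟩

theorem IsRich.density_pos (h : IsRich G A D ρ) (hχ : ∀ j, ∀ u ∈ B j, χ u ≠ χ j)
    {φ : ℕ → V} (hφ : ∀ u, φ u ∈ A (χ u)) (j : ℕ) : 0 < density G A B χ j φ := by
  have h1 := (h.cand_nonempty hχ (j := j) fun u _ => hφ u).card_pos
  have h2 := (h.class_nonempty (χ j)).card_pos
  unfold density
  positivity

/-- The weights `∏ density` undo the bias of the process towards tuples with unlikely images, so
that the moment condition for uniform tuples applies. -/
theorem IsRich.expect_weighted_le (h : IsRich G A D ρ) (hB : ∀ j, ∀ u ∈ B j, u < j)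
    (hBc : ∀ j, #(B j) ≤ D) (hχ : ∀ j, ∀ u ∈ B j, χ u ≠ χ j) {φ₀ : ℕ → V}
    (hφ₀ : ∀ u, φ₀ u ∈ A (χ u)) {n v : ℕ} (hv : v < n) :
    expect (choices G A B χ) φ₀ n
      (fun φ => (1 / density G A B χ v φ) ^ (2 * D) * ∏ u ∈ B v, density G A B χ u φ)
      ≤ 2 ^ D * ρ ^ (3 * D) := by
  classical
  set N : ℝ := (Fintype.card V : ℝ) with hN
  have hN0 : 0 < N := h.card_pos (χ v)
  have hρ : 1 ≤ ρ := h.one_le (χ v)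
  set k := #(B v) with hk
  let e : Fin k ≃ B v := (B v).equivFin.symm
  let ext : (Fin k → V) → ℕ → V := fun x u =>
    if hu : u ∈ B v then x (e.symm ⟨u, hu⟩) else φ₀ u
  let w : (Fin k → V) → ℝ := fun x =>
    (#(A (χ v)) / (#(commonIn G (A (χ v)) (univ.image x)) : ℝ)) ^ (2 * D)
  let Φ : Finset (Fin k → V) := Fintype.piFinset fun i => A (χ (e i))
  have hfil : (B v).filter (· < n) = B v :=
    filter_true_of_mem fun u hu => (hB v u hu).trans hv
  have hpt : ∀ φ : ℕ → V, (∀ u, φ u ∈ A (χ u)) →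
      (1 / density G A B χ v φ) ^ (2 * D) * ∏ u ∈ B v, density G A B χ u φ
      ≤ ∑ x ∈ Φ, w x * ∏ u ∈ B v with u < n,
          if φ u = ext x u then density G A B χ u φ else 0 := by
    intro φ hφ
    let x₀ : Fin k → V := fun i => φ (e i)
    have hx₀ : x₀ ∈ Φ := Fintype.mem_piFinset.2 fun i => hφ _
    have himg : univ.image x₀ = (B v).image φ := by
      ext y
      simp only [mem_image, mem_univ, true_and, x₀]
      constructor
      · rintro ⟨i, rfl⟩
        exact ⟨e i, (e i).2, rfl⟩
      · rintro ⟨u, hu, rfl⟩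
        exact ⟨e.symm ⟨u, hu⟩, by simp⟩
    refine le_trans (le_of_eq ?_) (single_le_sum (f := fun x => w x * ∏ u ∈ B v with u < n,
      if φ u = ext x u then density G A B χ u φ else 0) (fun x _ => ?_) hx₀)
    · simp only [w]
      rw [himg, hfil]
      congr 1
      · congr 1
        unfold density cand
        rw [one_div_div]
      · refine prod_congr rfl fun u hu => ?_
        rw [if_pos]
        simp [ext, x₀, hu]
    · refine mul_nonneg (by positivity) (prod_nonneg fun u _ => ?_)
      split_ifs
      · exact density_nonneg _ _
      · exact le_rfl
  refine (expect_mono (P := fun φ => ∀ u, φ u ∈ A (χ u)) hφ₀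
    (fun j φ hφ x hx => mem_class_update hφ hx) hpt n).trans ?_
  rw [expect_sum (choices_nonempty h.class_nonempty)]
  have hfac : ∀ u, 2 / (#(A (χ u)) : ℝ) ≤ 2 * ρ / N := by
    intro u
    have h1 := h.card_le (χ u)
    have h3 : (0 : ℝ) < #(A (χ u)) := by exact_mod_cast (h.class_nonempty _).card_pos
    rw [div_le_div_iff₀ h3 hN0]
    linarith
  have hAN : (#(A (χ v)) : ℝ) ≤ N := Nat.cast_le.2 (card_le_univ _)
  calc ∑ x ∈ Φ, expect (choices G A B χ) φ₀ n (fun φ => w x * ∏ u ∈ B v with u < n,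
          if φ u = ext x u then density G A B χ u φ else 0)
      ≤ ∑ x ∈ Φ, w x * (2 * ρ / N) ^ k := by
        refine sum_le_sum fun x _ => ?_
        rw [expect_mul_left]
        refine mul_le_mul_of_nonneg_left ?_ (by positivity)
        refine (expect_prod_ite_le h.class_nonempty hB φ₀ (B v) (ext x) n).trans ?_
        rw [hfil, hk, ← prod_const]
        exact prod_le_prod (fun u _ => by positivity) fun u _ => hfac u
    _ ≤ ∑ x ∈ Φ, (N ^ (2 * D) * (1 / (#(commonIn G (A (χ v)) (univ.image x)) : ℝ)) ^ (2 * D))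
          * (2 * ρ / N) ^ k := by
        refine sum_le_sum fun x _ => ?_
        simp only [w]
        rw [← mul_pow, mul_one_div]
        gcongr
    _ = N ^ (2 * D) * (2 * ρ / N) ^ k *
          ∑ x ∈ Φ, (1 / (#(commonIn G (A (χ v)) (univ.image x)) : ℝ)) ^ (2 * D) := by
        rw [mul_sum]
        exact sum_congr rfl fun x _ => by ring
    _ ≤ N ^ (2 * D) * (2 * ρ / N) ^ k * (ρ ^ (2 * D) * N ^ k / N ^ (2 * D)) := by
        refine mul_le_mul_of_nonneg_left ?_ (by positivity)
        exact h.moment (χ v) k (hBc v) (fun i => χ (e i)) fun i => hχ v _ (e i).2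
    _ = (2 * ρ) ^ k * ρ ^ (2 * D) := by
        rw [div_pow]
        field_simp
    _ ≤ (2 * ρ) ^ D * ρ ^ (2 * D) := by
        gcongr
        · linarith
        · exact hBc v
    _ = _ := by
        rw [mul_pow]
        ring

/-- All negative moments of order `D` of the candidate densities are bounded by the same
constant. By the inequality between the arithmetic and the geometric mean, the moment at `v` is at
most the average of a weighted moment and of the moments at the back neighbors of `v`, so the bound
propagates along the vertex order without any loss. -/
theorem IsRich.expect_inv_density_pow_le (h : IsRich G A D ρ) (hB : ∀ j, ∀ u ∈ B j, u < j)
    (hBc : ∀ j, #(B j) ≤ D) (hχ : ∀ j, ∀ u ∈ B j, χ u ≠ χ j) {φ₀ : ℕ → V}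
    (hφ₀ : ∀ u, φ₀ u ∈ A (χ u)) {n v : ℕ} (hv : v < n) :
    expect (choices G A B χ) φ₀ n (fun φ => (1 / density G A B χ v φ) ^ D)
      ≤ 2 ^ D * ρ ^ (3 * D) := by
  induction v using Nat.strong_induction_on with
  | _ v ih =>
  have hρ : 1 ≤ ρ := h.one_le (χ v)
  have hM : (1 : ℝ) ≤ 2 ^ D * ρ ^ (3 * D) :=
    one_le_mul_of_one_le_of_one_le (one_le_pow₀ (by norm_num)) (one_le_pow₀ hρ)
  set M : ℝ := 2 ^ D * ρ ^ (3 * D)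
  have hprod : expect (choices G A B χ) φ₀ n (fun φ => ∏ u ∈ B v, 1 / density G A B χ u φ) ≤ M := by
    rcases (B v).eq_empty_or_nonempty with hE | hE
    · simp only [hE, prod_empty]
      rwa [expect_const (choices_nonempty h.class_nonempty)]
    · have hc : (0 : ℝ) < #(B v) := by exact_mod_cast hE.card_pos
      calc _ ≤ expect (choices G A B χ) φ₀ n (fun φ => (#(B v) : ℝ)⁻¹ *
                ∑ u ∈ B v, (1 / density G A B χ u φ) ^ D) := by
            refine expect_mono (P := fun φ => ∀ u, φ u ∈ A (χ u)) hφ₀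
              (fun j φ hφ x hx => mem_class_update hφ hx) (fun φ hφ => ?_) n
            rw [← div_eq_inv_mul]
            refine prod_le_sum_pow_div_card _ hE _ (fun u _ => ?_) (hBc v)
            rw [one_le_div (h.density_pos hχ hφ u)]
            exact density_le_one u φ
        _ = (#(B v) : ℝ)⁻¹ * ∑ u ∈ B v, expect (choices G A B χ) φ₀ n
                (fun φ => (1 / density G A B χ u φ) ^ D) := by
            rw [expect_mul_left, expect_sum (choices_nonempty h.class_nonempty)]
        _ ≤ (#(B v) : ℝ)⁻¹ * ∑ u ∈ B v, M := by
            gcongr with u hu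
            exact ih u (hB v u hu) ((hB v u hu).trans hv)
        _ = M := by
            rw [sum_const, nsmul_eq_mul]
            field_simp
  calc _ ≤ expect (choices G A B χ) φ₀ n (fun φ => 2⁻¹ *
            ((1 / density G A B χ v φ) ^ (2 * D) * (∏ u ∈ B v, density G A B χ u φ)
              + ∏ u ∈ B v, 1 / density G A B χ u φ)) := by
        refine expect_mono (P := fun φ => ∀ u, φ u ∈ A (χ u)) hφ₀
          (fun j φ hφ x hx => mem_class_update hφ hx) (fun φ hφ => ?_) n
        exact one_div_pow_le_add_prod (B v) _ (fun u _ => h.density_pos hχ hφ u) _ D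
    _ ≤ 2⁻¹ * (M + M) := by
        rw [expect_mul_left, expect_add]
        gcongr
        exact h.expect_weighted_le hB hBc hχ hφ₀ hv
    _ = M := by ring

theorem IsRich.expect_inv_card_cand_pow_le (h : IsRich G A D ρ) (hB : ∀ j, ∀ u ∈ B j, u < j)
    (hBc : ∀ j, #(B j) ≤ D) (hχ : ∀ j, ∀ u ∈ B j, χ u ≠ χ j) {φ₀ : ℕ → V}
    (hφ₀ : ∀ u, φ₀ u ∈ A (χ u)) {n v : ℕ} (hv : v < n) :
    expect (choices G A B χ) φ₀ n (fun φ => (1 / (#(cand G A B χ v φ) : ℝ)) ^ D)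
      ≤ (2 * ρ ^ 4 / Fintype.card V) ^ D := by
  have hA : (0 : ℝ) < #(A (χ v)) := by exact_mod_cast (h.class_nonempty _).card_pos
  have hρ : 1 ≤ ρ := h.one_le (χ v)
  have hN := h.card_pos (χ v)
  have heq : (fun φ : ℕ → V => (1 / (#(cand G A B χ v φ) : ℝ)) ^ D)
      = fun φ => (1 / (#(A (χ v)) : ℝ)) ^ D * (1 / density G A B χ v φ) ^ D := by
    ext φ
    rw [← mul_pow]
    congr 1
    unfold density
    rw [one_div_div]
    field_simp
  rw [heq, expect_mul_left]
  calc _ ≤ (1 / (#(A (χ v)) : ℝ)) ^ D * (2 ^ D * ρ ^ (3 * D)) := by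
        gcongr
        exact h.expect_inv_density_pow_le hB hBc hχ hφ₀ hv
    _ ≤ (ρ / Fintype.card V) ^ D * (2 ^ D * ρ ^ (3 * D)) := by
        have : 1 / (#(A (χ v)) : ℝ) ≤ ρ / Fintype.card V := by
          rw [div_le_div_iff₀ hA hN]
          linarith [h.card_le (χ v)]
        gcongr
    _ = _ := by
        rw [pow_mul, ← mul_pow, ← mul_pow]
        congr 1
        ring

end Moments

/-! ### Embedding into a rich system of classes -/

theorem exists_option_tuple {V : Type v} (K : Finset V) {D : ℕ} (hK : #K ≤ D) :
    ∃ x : Fin D → Option V, ∀ z, z ∈ K ↔ ∃ i, x i = some z := by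
  refine ⟨fun i => if h : (i : ℕ) < #K then some (K.equivFin.symm ⟨i, h⟩ : V) else none,
    fun z => ⟨fun hz => ?_, ?_⟩⟩
  · refine ⟨⟨K.equivFin ⟨z, hz⟩, (K.equivFin ⟨z, hz⟩).2.trans_le hK⟩, ?_⟩
    simp
  · rintro ⟨i, hi⟩
    dsimp only at hi
    split_ifs at hi with h
    simp only [Option.some.injEq] at hi
    exact hi ▸ (K.equivFin.symm ⟨i, h⟩).2

section Embedding

variable {V : Type v} [Fintype V] {G : SimpleGraph V} {R : Type*} {A : R → Finset V}
  {B : ℕ → Finset ℕ} {χ : ℕ → R} {D : ℕ} {ρ : ℝ}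

open Classical in
/-- There are few sets of the form "common neighborhood of at most `D` vertices in a class". -/
theorem exists_family_commonIn [Fintype R] (G : SimpleGraph V) (A : R → Finset V) (D : ℕ) :
    ∃ 𝒮 : Finset (Finset V), #𝒮 ≤ Fintype.card R * (Fintype.card V + 1) ^ D ∧
      ∀ e (K : Finset V), #K ≤ D → commonIn G (A e) K ∈ 𝒮 := by
  refine ⟨(univ : Finset (R × (Fin D → Option V))).image fun p =>
    commonIn G (A p.1) (univ.filter fun z => ∃ i, p.2 i = some z), ?_, ?_⟩
  · refine card_image_le.trans ?_
    simp
  · intro e K hK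
    obtain ⟨x, hx⟩ := exists_option_tuple K hK
    refine mem_image.2 ⟨(e, x), mem_univ _, ?_⟩
    congr 1
    ext z
    simp [hx]

/-- If the class structure `A` is rich enough, then every graph on `n` vertices with a vertex
order in which each vertex has at most `D` back neighbors, and with a proper coloring by the indices
of the classes, can be embedded. -/
theorem IsRich.exists_embedding [Fintype R] (h : IsRich G A D ρ) (hD : 2 ≤ D)
    (hB : ∀ j, ∀ u ∈ B j, u < j) (hBc : ∀ j, #(B j) ≤ D) (hχ : ∀ j, ∀ u ∈ B j, χ u ≠ χ j)
    {n : ℕ} (hn : 256 * ρ ^ 4 * n ≤ Fintype.card V) {s₀ : ℝ} (hs₀ : 0 < s₀)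
    (hs₁ : s₀ ^ 2 * ρ ^ 4 ≤ 8 * Fintype.card V) (hs₂ : 2 * s₀ * ρ ^ 4 ≤ Fintype.card V)
    (hs₃ : Fintype.card R * ((Fintype.card V : ℝ) + 1) ^ D * Real.exp (-(s₀ / 4)) ≤ 1 / 4) :
    ∃ φ : ℕ → V, Set.InjOn φ (Set.Iio n) ∧ ∀ j < n, ∀ u ∈ B j, G.Adj (φ u) (φ j) := by
  classical
  choose z hz using h.class_nonempty
  let φ₀ : ℕ → V := fun u => z (χ u)
  have hφ₀ : ∀ u, φ₀ u ∈ A (χ u) := fun u => hz _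
  obtain ⟨𝒮, h𝒮c, h𝒮⟩ := exists_family_commonIn G A D
  have hN0 := h.card_pos (χ 0)
  have hρ := h.one_le (χ 0)
  set N : ℝ := (Fintype.card V : ℝ) with hN
  set E := expect (choices G A B χ) φ₀ n with hE
  set τ : ℝ := 2 * ρ ^ 4 / N with hτ
  have hτ0 : 0 < τ := by positivity
  have hTne := choices_nonempty (G := G) (B := B) (χ := χ) h.class_nonempty
  have hmono : ∀ {F F' : (ℕ → V) → ℝ}, (∀ φ, (∀ u, φ u ∈ A (χ u)) → F φ ≤ F' φ) → E F ≤ E F' :=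
    fun hle => expect_mono (P := fun φ => ∀ u, φ u ∈ A (χ u)) hφ₀
      (fun j φ hφ x hx => mem_class_update hφ hx) hle n
  have hmom : ∀ v < n, E (fun φ => (1 / (#(cand G A B χ v φ) : ℝ)) ^ D) ≤ τ ^ D := fun v hv =>
    h.expect_inv_card_cand_pow_le hB hBc hχ hφ₀ hv
  let Z : (ℕ → V) → ℝ := fun φ => ∑ i ∈ range n, 2 / (#(cand G A B χ i φ) : ℝ)
  let cnt : Finset V → (ℕ → V) → ℝ := fun S φ =>
    ∑ i ∈ range n, (S : Set V).indicator (fun _ => (1 : ℝ)) (φ i)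
  -- The sizes of the candidate sets are large on average,
  have hX₁ : E (fun φ => 8 * Z φ) ≤ 1 / 4 := by
    have hone : ∀ v < n, E (fun φ => 2 / (#(cand G A B χ v φ) : ℝ)) ≤ 4 * τ := by
      intro v hv
      calc _ ≤ E (fun φ => 2 * τ + 2 * (τ * (1 / τ) ^ D)
                * (1 / (#(cand G A B χ v φ) : ℝ)) ^ D) := by
            refine hmono fun φ _ => ?_
            set y := 1 / (#(cand G A B χ v φ) : ℝ) with hy
            have hy0 : 0 ≤ y := by positivity
            have : y ≤ τ + τ * (y / τ) ^ D := by
              rcases le_total y τ with hle | hle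
              · have : 0 ≤ τ * (y / τ) ^ D := by positivity
                linarith
              · have h1 : y / τ ≤ (y / τ) ^ D :=
                  le_self_pow₀ ((one_le_div hτ0).2 hle) (by omega)
                have h2 : τ * (y / τ) ≤ τ * (y / τ) ^ D := by gcongr
                rw [mul_div_cancel₀ _ hτ0.ne'] at h2
                linarith
            have h2 : 2 / (#(cand G A B χ v φ) : ℝ) = 2 * y := by rw [hy]; ring
            have h3 : (y / τ) ^ D = (1 / τ) ^ D * y ^ D := by rw [← mul_pow]; congr 1; ring
            rw [h2]
            rw [h3] at this
            linarith
        _ ≤ 2 * τ + 2 * (τ * (1 / τ) ^ D) * τ ^ D := by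
            rw [hE, expect_add, expect_const hTne, expect_mul_left, ← hE]
            gcongr
            exact hmom v hv
        _ = 4 * τ := by
            rw [mul_assoc, mul_assoc, ← mul_pow, one_div_mul_cancel hτ0.ne', one_pow]
            ring
    calc _ = 8 * ∑ i ∈ range n, E (fun φ => 2 / (#(cand G A B χ i φ) : ℝ)) := by
          rw [hE, expect_mul_left, expect_sum hTne]
      _ ≤ 8 * ∑ i ∈ range n, 4 * τ := by
          gcongr with i hi
          exact hone i (mem_range.1 hi)
      _ = 64 * ρ ^ 4 * n / N := by
          rw [sum_const, card_range, nsmul_eq_mul, hτ]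
          ring
      _ ≤ 1 / 4 := by
          rw [div_le_div_iff₀ hN0 (by norm_num)]
          linarith
  -- with high probability none of them is tiny,
  have hX₂ : E (fun φ => s₀ ^ D * ∑ v ∈ range n, (1 / (#(cand G A B χ v φ) : ℝ)) ^ D) ≤ 1 / 4 := by
    calc _ = s₀ ^ D * ∑ v ∈ range n, E (fun φ => (1 / (#(cand G A B χ v φ) : ℝ)) ^ D) := by
          rw [hE, expect_mul_left, expect_sum hTne]
      _ ≤ s₀ ^ D * ∑ v ∈ range n, τ ^ D := by
          gcongr with i hi
          exact hmom i (mem_range.1 hi)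
      _ = n * (s₀ * τ) ^ D := by
          rw [sum_const, card_range, nsmul_eq_mul, mul_pow]
          ring
      _ ≤ n * (s₀ * τ) ^ 2 := by
          gcongr ?_ * ?_
          refine pow_le_pow_of_le_one (by positivity) ?_ hD
          rw [hτ, mul_div_assoc', div_le_one hN0]
          linarith
      _ = (4 * s₀ ^ 2 * ρ ^ 4) * (ρ ^ 4 * n) / N ^ 2 := by
          rw [hτ]
          field_simp
          ring
      _ ≤ (4 * (8 * N)) * (N / 256) / N ^ 2 := by
          gcongr ?_ * ?_ / _
          · linarith
          · linarith
      _ ≤ 1 / 4 := by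
          field_simp
          norm_num
  -- and they are not exhausted by the vertices embedded before.
  have hX₃ : E (fun φ => ∑ S ∈ 𝒮 with s₀ ≤ #S,
      Real.exp (cnt S φ - 2 * #S * Z φ - #S / 4)) ≤ 1 / 4 := by
    calc _ = ∑ S ∈ 𝒮 with s₀ ≤ #S, E (fun φ =>
            Real.exp (-(#S / 4)) * Real.exp (cnt S φ - 2 * #S * Z φ)) := by
          rw [hE, expect_sum hTne]
          refine sum_congr rfl fun S _ => ?_
          congr 1
          ext φ
          rw [← Real.exp_add]
          congr 1
          ring
      _ ≤ ∑ S ∈ 𝒮 with s₀ ≤ #S, Real.exp (-(s₀ / 4)) := by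
          refine sum_le_sum fun S hS => ?_
          rw [hE, expect_mul_left]
          have h1 := expect_exp_count_le (G := G) h.class_nonempty hB hφ₀
            (fun j φ hφ x hx => mem_class_update hφ hx)
            (fun φ hφ j => h.cand_nonempty hχ fun u _ => hφ u) S n
          have h2 : Real.exp (-((#S : ℝ) / 4)) ≤ Real.exp (-(s₀ / 4)) := by
            have := (mem_filter.1 hS).2
            gcongr
          calc _ ≤ Real.exp (-((#S : ℝ) / 4)) * 1 := by gcongr
            _ ≤ _ := by linarith
      _ ≤ #𝒮 * Real.exp (-(s₀ / 4)) := by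
          rw [sum_const, nsmul_eq_mul]
          gcongr
          exact filter_subset _ _
      _ ≤ Fintype.card R * (N + 1) ^ D * Real.exp (-(s₀ / 4)) := by
          gcongr
          rw [hN]
          exact_mod_cast h𝒮c
      _ ≤ 1 / 4 := hs₃
  obtain ⟨φ, hφ, hmem⟩ := exists_le_expect (φ₀ := φ₀) hTne
    (fun i j φ x hij => choices_update hB hij φ x)
    (fun φ => 8 * Z φ + (s₀ ^ D * ∑ v ∈ range n, (1 / (#(cand G A B χ v φ) : ℝ)) ^ D
      + ∑ S ∈ 𝒮 with s₀ ≤ #S, Real.exp (cnt S φ - 2 * #S * Z φ - #S / 4))) n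
  rw [expect_add, expect_add, ← hE] at hφ
  have hZ0 : 0 ≤ Z φ := sum_nonneg fun _ _ => by positivity
  have hY0 : 0 ≤ s₀ ^ D * ∑ v ∈ range n, (1 / (#(cand G A B χ v φ) : ℝ)) ^ D :=
    mul_nonneg (by positivity) (sum_nonneg fun _ _ => by positivity)
  have hW0 : 0 ≤ ∑ S ∈ 𝒮 with s₀ ≤ #S, Real.exp (cnt S φ - 2 * #S * Z φ - #S / 4) :=
    sum_nonneg fun _ _ => by positivity
  have hZ1 : 8 * Z φ < 1 := by linarith
  have hY1 : s₀ ^ D * ∑ v ∈ range n, (1 / (#(cand G A B χ v φ) : ℝ)) ^ D < 1 := by linarith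
  have hW1 : ∑ S ∈ 𝒮 with s₀ ≤ #S, Real.exp (cnt S φ - 2 * #S * Z φ - #S / 4) < 1 := by linarith
  have hchoice : ∀ j < n, φ j ∈ cand G A B χ j φ \ (range j).image φ := by
    intro j hj
    have hne : (cand G A B χ j φ).Nonempty := h.cand_nonempty hχ fun u hu =>
      choices_subset u φ (hmem u ((hB j u hu).trans hj))
    have hpos : (0 : ℝ) < #(cand G A B χ j φ) := by exact_mod_cast hne.card_pos
    have hlarge : s₀ ≤ #(cand G A B χ j φ) := by
      have h1 : (s₀ * (1 / (#(cand G A B χ j φ) : ℝ))) ^ D < 1 := by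
        rw [mul_pow]
        refine lt_of_le_of_lt ?_ hY1
        gcongr
        exact single_le_sum (f := fun v => (1 / (#(cand G A B χ v φ) : ℝ)) ^ D)
          (fun _ _ => by positivity) (mem_range.2 hj)
      have h2 : s₀ * (1 / (#(cand G A B χ j φ) : ℝ)) < 1 := by
        by_contra hcon
        exact absurd h1 (not_lt.2 (one_le_pow₀ (not_lt.1 hcon)))
      rw [mul_one_div, div_lt_one hpos] at h2
      exact h2.le
    set S := cand G A B χ j φ with hS
    have hS𝒮 : S ∈ 𝒮.filter fun S => s₀ ≤ (#S : ℝ) :=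
      mem_filter.2 ⟨h𝒮 _ _ (card_image_le.trans (hBc j)), hlarge⟩
    have hexp : Real.exp (cnt S φ - 2 * #S * Z φ - #S / 4) < 1 :=
      lt_of_le_of_lt (single_le_sum (f := fun S : Finset V =>
        Real.exp (cnt S φ - 2 * #S * Z φ - #S / 4)) (fun _ _ => by positivity) hS𝒮) hW1
    have hcnt : cnt S φ < #S / 2 := by
      have := Real.exp_lt_one_iff.1 hexp
      nlinarith
    have himg : (#(S ∩ (range j).image φ) : ℝ) ≤ cnt S φ := by
      have h1 : S ∩ (range j).image φ ⊆ ((range j).filter (φ · ∈ S)).image φ := by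
        intro y hy
        obtain ⟨hy1, hy2⟩ := mem_inter.1 hy
        obtain ⟨u, hu, rfl⟩ := mem_image.1 hy2
        exact mem_image_of_mem _ (mem_filter.2 ⟨hu, hy1⟩)
      have h2 : (#((range j).filter (φ · ∈ S)) : ℝ) ≤ cnt S φ := by
        rw [← sum_boole]
        simp only [cnt, Set.indicator, mem_coe]
        exact sum_le_sum_of_subset_of_nonneg (range_subset_range.2 hj.le)
          fun i _ _ => by split_ifs <;> norm_num
      exact le_trans (by exact_mod_cast (card_le_card h1).trans card_image_le) h2
    have hcard : #S ≤ 2 * #(S \ (range j).image φ) := by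
      have h1 := card_sdiff_add_card_inter S ((range j).image φ)
      have h2 : (2 * #(S ∩ (range j).image φ) : ℝ) < #S := by linarith
      have h3 : 2 * #(S ∩ (range j).image φ) < #S := by exact_mod_cast h2
      omega
    have := hmem j hj
    rwa [choices, ← hS, if_pos ⟨hcard, hne⟩] at this
  refine ⟨φ, ?_, fun j hj u hu => ?_⟩
  · have hlt : ∀ i j, i < j → j < n → φ i ≠ φ j := fun i j hij hj heq =>
      (mem_sdiff.1 (hchoice j hj)).2 (mem_image.2 ⟨i, mem_range.2 hij, heq⟩)
    intro i hi j hj heq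
    rcases lt_trichotomy i j with hij | hij | hij
    · exact absurd heq (hlt i j hij hj)
    · exact hij
    · exact absurd heq.symm (hlt j i hij hi)
  · have := (mem_sdiff.1 (hchoice j hj)).1
    exact (mem_commonIn.1 this).2 _ (mem_image_of_mem φ hu)

end Embedding

/-! ### Counting cliques and dependent random choice -/

section Cliques

variable {V : Type v} [Fintype V]

open Classical in
/-- The number of ordered `q`-tuples of vertices of `S` that are pairwise adjacent in `G`. -/
noncomputable def cliqueCount (G : SimpleGraph V) (q : ℕ) (S : Finset V) : ℕ :=
  #{y : Fin q → V | (∀ i, y i ∈ S) ∧ Pairwise fun i j => G.Adj (y i) (y j)}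

theorem cliqueCount_zero (G : SimpleGraph V) (S : Finset V) : cliqueCount G 0 S = 1 := by
  simp [cliqueCount, Pairwise]

theorem cliqueCount_mono (G : SimpleGraph V) (q : ℕ) {S S' : Finset V} (h : S ⊆ S') :
    cliqueCount G q S ≤ cliqueCount G q S' := by
  classical
  refine card_le_card fun y hy => ?_
  simp only [mem_filter, mem_univ, true_and] at hy ⊢
  exact ⟨fun i => h (hy.1 i), hy.2⟩

theorem sum_cliqueCount_le (G : SimpleGraph V) (q : ℕ) {S S₁ : Finset V} (h : S₁ ⊆ S) :
    ∑ x ∈ S₁, cliqueCount G q (commonIn G S {x}) ≤ cliqueCount G (q + 1) S := by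
  classical
  unfold cliqueCount
  rw [← card_sigma]
  refine card_le_card_of_injOn (fun p => (Fin.cons p.1 p.2 : Fin (q + 1) → V)) ?_ ?_
  · rintro ⟨x, y⟩ hp
    simp only [coe_sigma, Set.mem_sigma_iff, mem_coe, mem_filter, mem_univ, true_and,
      mem_commonIn, mem_singleton, forall_eq] at hp
    simp only [mem_coe, mem_filter, mem_univ, true_and]
    refine ⟨fun i => ?_, fun i j hij => ?_⟩
    · refine Fin.cases ?_ (fun i => ?_) i
      · simpa using h hp.1
      · simpa using (hp.2.1 i).1
    · rcases Fin.eq_zero_or_eq_succ i with rfl | ⟨i, rfl⟩ <;>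
        rcases Fin.eq_zero_or_eq_succ j with rfl | ⟨j, rfl⟩
      · exact absurd rfl hij
      · simpa using (hp.2.1 j).2
      · simpa using (hp.2.1 i).2.symm
      · simpa using hp.2.2 fun hh => hij (by rw [hh])
  · rintro ⟨x, y⟩ - ⟨x', y'⟩ - hp
    simp only [Fin.cons_inj] at hp
    obtain ⟨rfl, rfl⟩ := hp
    rfl

/-- The inductive step of the Erdős–Szekeres argument, in the case that at least half of the
vertices have large `G`-degree. -/
theorem card_pow_le_cliqueCount_step {G G' : SimpleGraph V} {a b s : ℕ} {S S₁ : Finset V}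
    (hS₁ : S₁ ⊆ S) (hhalf : #S ≤ 2 * #S₁) (hdeg : ∀ x ∈ S₁, #S ≤ 4 * #(commonIn G S {x}))
    (hS : 4 ^ (s + 1) ≤ #S)
    (ih : ∀ U : Finset V, 4 ^ s ≤ #U →
      #U ^ a ≤ cliqueCount G a U * 4 ^ (s * a) ∨ #U ^ b ≤ cliqueCount G' b U * 4 ^ (s * b)) :
    #S ^ (a + 1) ≤ cliqueCount G (a + 1) S * 4 ^ ((s + 1) * (a + 1)) ∨
      #S ^ b ≤ cliqueCount G' b S * 4 ^ ((s + 1) * b) := by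
  have hbig : ∀ x ∈ S₁, 4 ^ s ≤ #(commonIn G S {x}) := by
    intro x hx
    have := hdeg x hx
    rw [pow_succ] at hS
    omega
  by_cases hex : ∃ x ∈ S₁, #(commonIn G S {x}) ^ b
      ≤ cliqueCount G' b (commonIn G S {x}) * 4 ^ (s * b)
  · obtain ⟨x, hx, hle⟩ := hex
    right
    calc #S ^ b ≤ (4 * #(commonIn G S {x})) ^ b := Nat.pow_le_pow_left (hdeg x hx) b
      _ = 4 ^ b * #(commonIn G S {x}) ^ b := mul_pow _ _ _
      _ ≤ 4 ^ b * (cliqueCount G' b S * 4 ^ (s * b)) := by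
          refine Nat.mul_le_mul_left _ (hle.trans ?_)
          exact Nat.mul_le_mul_right _ (cliqueCount_mono _ _ commonIn_subset)
      _ = cliqueCount G' b S * 4 ^ ((s + 1) * b) := by ring
  · push Not at hex
    left
    calc #S ^ (a + 1) = #S * #S ^ a := by ring
      _ ≤ 2 * #S₁ * #S ^ a := Nat.mul_le_mul_right _ hhalf
      _ = 2 * ∑ x ∈ S₁, #S ^ a := by
          rw [sum_const, smul_eq_mul]
          ring
      _ ≤ 2 * ∑ x ∈ S₁, 4 ^ a * (cliqueCount G a (commonIn G S {x}) * 4 ^ (s * a)) := by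
          refine Nat.mul_le_mul_left _ (sum_le_sum fun x hx => ?_)
          calc #S ^ a ≤ (4 * #(commonIn G S {x})) ^ a := Nat.pow_le_pow_left (hdeg x hx) a
            _ = 4 ^ a * #(commonIn G S {x}) ^ a := mul_pow _ _ _
            _ ≤ _ := Nat.mul_le_mul_left _
                ((ih _ (hbig x hx)).resolve_right (not_le.2 (hex x hx)))
      _ = 2 * 4 ^ ((s + 1) * a) * ∑ x ∈ S₁, cliqueCount G a (commonIn G S {x}) := by
          rw [mul_assoc, mul_sum (a := 4 ^ ((s + 1) * a))]
          congr 1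
          exact sum_congr rfl fun x _ => by ring
      _ ≤ 4 ^ (s + 1) * 4 ^ ((s + 1) * a) * cliqueCount G (a + 1) S := by
          refine Nat.mul_le_mul (Nat.mul_le_mul_right _ ?_) (sum_cliqueCount_le G a hS₁)
          have : 0 < 4 ^ s := by positivity
          rw [pow_succ]
          omega
      _ = _ := by ring

/-- A counting version of the Erdős–Szekeres bound on Ramsey numbers: if any two vertices are
adjacent in `G` or in `G'`, then one of these graphs has a positive proportion of cliques. -/
theorem card_pow_le_cliqueCount {G G' : SimpleGraph V}
    (hG : ∀ x y, x ≠ y → G.Adj x y ∨ G'.Adj x y) (s a b : ℕ) (hab : a + b = s)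
    (S : Finset V) (hS : 4 ^ s ≤ #S) :
    #S ^ a ≤ cliqueCount G a S * 4 ^ (s * a) ∨ #S ^ b ≤ cliqueCount G' b S * 4 ^ (s * b) := by
  classical
  induction s generalizing a b S with
  | zero =>
    obtain rfl : a = 0 := by omega
    left
    simp [cliqueCount_zero]
  | succ s ih =>
    rcases a with _ | a
    · left
      simp [cliqueCount_zero]
    rcases b with _ | b
    · right
      simp [cliqueCount_zero]
    have hS4 : 4 ≤ #S := by
      have : 0 < 4 ^ s := by positivity
      rw [pow_succ] at hS
      omega
    have hor : ∀ x ∈ S, #S ≤ 4 * #(commonIn G S {x}) ∨ #S ≤ 4 * #(commonIn G' S {x}) := by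
      intro x hx
      have h1 : S.erase x ⊆ commonIn G S {x} ∪ commonIn G' S {x} := by
        intro y hy
        obtain ⟨hne, hy⟩ := mem_erase.1 hy
        simp only [mem_union, mem_commonIn, mem_singleton, forall_eq]
        exact (hG x y hne.symm).imp (⟨hy, ·⟩) (⟨hy, ·⟩)
      have h2 := (card_le_card h1).trans (card_union_le _ _)
      rw [card_erase_of_mem hx] at h2
      omega
    have hsplit := card_filter_add_card_filter_not (s := S)
      (fun x => #S ≤ 4 * #(commonIn G S {x}))
    rcases le_total #(S.filter fun x => ¬ #S ≤ 4 * #(commonIn G S {x}))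
      #(S.filter fun x => #S ≤ 4 * #(commonIn G S {x})) with hle | hle
    · exact card_pow_le_cliqueCount_step
        (S₁ := S.filter fun x => #S ≤ 4 * #(commonIn G S {x})) (filter_subset _ _) (by omega)
        (fun x hx => (mem_filter.1 hx).2) hS fun U hU => ih a (b + 1) (by omega) U hU
    · refine (card_pow_le_cliqueCount_step
        (S₁ := S.filter fun x => ¬ #S ≤ 4 * #(commonIn G S {x})) (filter_subset _ _) (by omega)
        (fun x hx => ?_) hS fun U hU => (ih (a + 1) b (by omega) U hU).symm).symm
      obtain ⟨hx1, hx2⟩ := mem_filter.1 hx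
      exact (hor x hx1).resolve_left hx2

end Cliques

section DependentRandomChoice

variable {V : Type v} [Fintype V] (G : SimpleGraph V) {r t : ℕ}

/-- The tuples `Y a` of vertices, one for each `a : Fin r`, form a complete `r`-partite graph. -/
def IsCompletePartite (Y : Fin r → Fin t → V) : Prop :=
  ∀ a b, a ≠ b → ∀ i j, G.Adj (Y a i) (Y b j)

open Classical in
/-- The common neighborhood of all tuples `Y a` with `a ≠ e`. -/
noncomputable def linkClass (Y : Fin r → Fin t → V) (e : Fin r) : Finset V :=
  univ.filter fun y => ∀ a, a ≠ e → ∀ i, G.Adj (Y a i) y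

open Classical in
/-- The sum of the `(-t)`-th powers of the numbers of common neighbors in the class `e`, over the
`k`-tuples with class pattern `a`. -/
noncomputable def momentSum (Y : Fin r → Fin t → V) (e : Fin r) {k : ℕ} (a : Fin k → Fin r) : ℝ :=
  ∑ x ∈ Fintype.piFinset fun i => linkClass G Y (a i),
    (1 / (#(commonIn G (linkClass G Y e) (univ.image x)) : ℝ)) ^ t

variable {G}

theorem momentSum_nonneg (Y : Fin r → Fin t → V) (e : Fin r) {k : ℕ} (a : Fin k → Fin r) :
    0 ≤ momentSum G Y e a :=
  sum_nonneg fun _ _ => by positivity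

open Classical in
/-- The mechanism of dependent random choice: when `x` is a tuple from the classes given by `Y`, the
tuple `Y e` has to lie in the common neighborhood of `x` in the class `e`, which itself does not
depend on `Y e`. So a tuple `x` for which this common neighborhood has `m` elements arises from at
most `m ^ t` choices of `Y e`, which makes up for its weight `m ^ (-t)`. -/
theorem sum_momentSum_le (e : Fin r) {k : ℕ} (a : Fin k → Fin r) (ha : ∀ i, a i ≠ e) :
    (Fintype.card V : ℝ) ^ t *
        ∑ Y : Fin r → Fin t → V with IsCompletePartite G Y, momentSum G Y e a
      ≤ (Fintype.card V : ℝ) ^ (r * t) * (Fintype.card V : ℝ) ^ k := by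
  let W := {b : Fin r // b ≠ e} → Fin t → V
  let σ : (Fin r → Fin t → V) ≃ (Fin t → V) × W := Equiv.funSplitAt e (Fin t → V)
  let S : W → (Fin k → V) → Finset V := fun w x =>
    commonIn G (univ.filter fun y => ∀ b (h : b ≠ e), ∀ i, G.Adj (w ⟨b, h⟩ i) y) (univ.image x)
  have hσ1 : ∀ z w, σ.symm (z, w) e = z := fun z w =>
    congrArg Prod.fst (σ.apply_symm_apply (z, w))
  have hσ2 : ∀ z w b (h : b ≠ e), σ.symm (z, w) b = w ⟨b, h⟩ := fun z w b h =>
    congrFun (congrArg Prod.snd (σ.apply_symm_apply (z, w))) ⟨b, h⟩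
  have hS : ∀ z w x, commonIn G (linkClass G (σ.symm (z, w)) e) (univ.image x) = S w x := by
    intro z w x
    simp only [S]
    congr 1
    unfold linkClass
    refine filter_congr fun y _ => ?_
    refine forall_congr' fun b => forall_congr' fun h => ?_
    rw [hσ2 z w b h]
  have hmem : ∀ z w x, IsCompletePartite G (σ.symm (z, w)) →
      (x ∈ Fintype.piFinset fun i => linkClass G (σ.symm (z, w)) (a i)) →
      z ∈ Fintype.piFinset fun _ : Fin t => S w x := by
    intro z w x hc hx
    rw [Fintype.mem_piFinset] at hx ⊢
    intro i
    rw [← hS z w x, mem_commonIn]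
    constructor
    · simp only [linkClass, mem_filter, mem_univ, true_and]
      intro b hb j
      have := hc b e hb j i
      rwa [hσ1] at this
    · intro y hy
      obtain ⟨l, -, rfl⟩ := mem_image.1 hy
      have := (mem_filter.1 (hx l)).2 e (ha l).symm i
      rw [hσ1] at this
      exact this.symm
  have hone : ∀ w x, ∑ z : Fin t → V, (if z ∈ Fintype.piFinset fun _ : Fin t => S w x then
      (1 / (#(S w x) : ℝ)) ^ t else 0) ≤ 1 := by
    intro w x
    rw [← sum_filter, sum_const, nsmul_eq_mul]
    have : (univ.filter fun z => z ∈ Fintype.piFinset fun _ : Fin t => S w x)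
        = Fintype.piFinset fun _ : Fin t => S w x := by ext; simp
    rw [this, Fintype.card_piFinset_const, Nat.cast_pow, ← mul_pow]
    refine pow_le_one₀ (by positivity) ?_
    rw [mul_one_div]
    exact div_self_le_one _
  have hcard : (Fintype.card V : ℝ) ^ t * Fintype.card W = (Fintype.card V : ℝ) ^ (r * t) := by
    have h := Fintype.card_congr σ
    rw [Fintype.card_prod] at h
    simp only [Fintype.card_pi, prod_const, card_univ, Fintype.card_fin] at h
    rw [mul_comm r t, pow_mul]
    exact_mod_cast h.symm
  have hsum : ∑ Y : Fin r → Fin t → V with IsCompletePartite G Y, momentSum G Y e a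
      ≤ ∑ w : W, ∑ x : Fin k → V, (1 : ℝ) := by
    calc _ = ∑ p : (Fin t → V) × W, if IsCompletePartite G (σ.symm p) then
              momentSum G (σ.symm p) e a else 0 := by
          rw [sum_filter]
          exact Fintype.sum_equiv σ _ _ fun Y => by simp
      _ = ∑ w : W, ∑ z : Fin t → V, if IsCompletePartite G (σ.symm (z, w)) then
              momentSum G (σ.symm (z, w)) e a else 0 := Fintype.sum_prod_type_right _
      _ ≤ ∑ w : W, ∑ z : Fin t → V, ∑ x : Fin k → V,
            (if z ∈ Fintype.piFinset fun _ : Fin t => S w x then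
              (1 / (#(S w x) : ℝ)) ^ t else 0) := by
          refine sum_le_sum fun w _ => sum_le_sum fun z _ => ?_
          split_ifs with hc
          · unfold momentSum
            simp only [hS]
            rw [← sum_filter]
            refine sum_le_sum_of_subset_of_nonneg (fun x hx => ?_) fun _ _ _ => by positivity
            exact mem_filter.2 ⟨mem_univ _, hmem z w x hc hx⟩
          · exact sum_nonneg fun x _ => by
              split_ifs
              · positivity
              · exact le_rfl
      _ ≤ _ := by
          refine sum_le_sum fun w _ => ?_
          rw [sum_comm]
          exact sum_le_sum fun x _ => hone w x
  calc _ ≤ (Fintype.card V : ℝ) ^ t * ∑ w : W, ∑ x : Fin k → V, (1 : ℝ) := by gcongr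
    _ = ((Fintype.card V : ℝ) ^ t * Fintype.card W) * (Fintype.card V : ℝ) ^ k := by
        simp only [sum_const, card_univ, nsmul_eq_mul, mul_one, Fintype.card_pi, prod_const,
          Fintype.card_fin, Nat.cast_pow]
        ring
    _ = _ := by rw [hcard]

open Classical in
theorem cliqueCount_le_card_isCompletePartite :
    cliqueCount G (r * t) univ ≤ #{Y : Fin r → Fin t → V | IsCompletePartite G Y} := by
  refine card_le_card_of_injOn (fun y a i => y (finProdFinEquiv (a, i))) ?_ ?_
  · intro y hy
    simp only [coe_filter, mem_univ, true_and, implies_true, Set.mem_ofPred_eq] at hy ⊢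
    intro a b hab i j
    exact hy fun h => hab (Prod.ext_iff.1 (finProdFinEquiv.injective h)).1
  · intro y _ y' _ h
    ext p
    obtain ⟨⟨a, i⟩, rfl⟩ := finProdFinEquiv.surjective p
    exact congrFun (congrFun h a) i

theorem card_patterns_le {r D : ℕ} (hr : 1 ≤ r) (hD : 1 ≤ D) :
    (Fintype.card (Fin r × (Σ k : Fin (D + 1), Fin k → Fin r)) : ℝ) *
      4 ^ (2 * (r * (2 * D)) * (r * (2 * D))) ≤ (2 ^ (10 * r ^ 2 * D) : ℝ) ^ (2 * D) := by
  have h1 : Fintype.card (Fin r × (Σ k : Fin (D + 1), Fin k → Fin r)) ≤ r * ((D + 1) * r ^ D) := by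
    simp only [Fintype.card_prod, Fintype.card_sigma, Fintype.card_pi, prod_const, card_univ,
      Fintype.card_fin]
    refine Nat.mul_le_mul_left _ ?_
    calc ∑ k : Fin (D + 1), r ^ (k : ℕ) ≤ ∑ k : Fin (D + 1), r ^ D :=
          sum_le_sum fun k _ => Nat.pow_le_pow_right hr (by omega)
      _ = _ := by simp
  have h2 : r * ((D + 1) * r ^ D) ≤ 2 ^ (r + (D + r * D)) := by
    have hr2 : r ≤ 2 ^ r := Nat.lt_two_pow_self.le
    rw [pow_add, pow_add, pow_mul]
    exact Nat.mul_le_mul hr2 (Nat.mul_le_mul Nat.lt_two_pow_self (Nat.pow_le_pow_left hr2 _))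
  have h3 : r + (D + r * D) + 2 * (2 * (r * (2 * D)) * (r * (2 * D))) ≤ 10 * r ^ 2 * D * (2 * D) := by
    have e0 : r * D ≤ (r * D) * (r * D) := Nat.le_mul_of_pos_left _ (Nat.mul_pos hr hD)
    have e1 : r ≤ r * D := Nat.le_mul_of_pos_right _ hD
    have e2 : D ≤ r * D := Nat.le_mul_of_pos_left _ hr
    nlinarith
  have h4 : Fintype.card (Fin r × (Σ k : Fin (D + 1), Fin k → Fin r)) *
      4 ^ (2 * (r * (2 * D)) * (r * (2 * D))) ≤ (2 ^ (10 * r ^ 2 * D)) ^ (2 * D) := by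
    calc _ ≤ 2 ^ (r + (D + r * D)) * (2 ^ 2) ^ (2 * (r * (2 * D)) * (r * (2 * D))) :=
          Nat.mul_le_mul_right _ (h1.trans h2)
      _ = 2 ^ (r + (D + r * D) + 2 * (2 * (r * (2 * D)) * (r * (2 * D)))) := by
          rw [← pow_mul, ← pow_add]
      _ ≤ 2 ^ (10 * r ^ 2 * D * (2 * D)) := Nat.pow_le_pow_right (by norm_num) h3
      _ = _ := by rw [pow_mul]
  exact_mod_cast h4

/-- A graph with a positive proportion of cliques has a rich system of `r` classes. -/
theorem exists_isRich [Nonempty V] {r D : ℕ} (hr : 1 ≤ r) (hD : 1 ≤ D)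
    (hG : Fintype.card V ^ (r * (2 * D))
      ≤ cliqueCount G (r * (2 * D)) univ * 4 ^ (2 * (r * (2 * D)) * (r * (2 * D)))) :
    ∃ A : Fin r → Finset V, IsRich G A D (2 ^ (10 * r ^ 2 * D)) := by
  classical
  set N : ℝ := (Fintype.card V : ℝ) with hN
  have hN0 : 0 < N := by rw [hN]; exact_mod_cast Fintype.card_pos
  set ρ : ℝ := 2 ^ (10 * r ^ 2 * D) with hρ
  have hρ0 : 0 < ρ := by positivity
  set 𝒴 : Finset (Fin r → Fin (2 * D) → V) := univ.filter fun Y => IsCompletePartite G Y with h𝒴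
  have hcount : N ^ (r * (2 * D)) ≤ #𝒴 * 4 ^ (2 * (r * (2 * D)) * (r * (2 * D))) := by
    have h1 := hG.trans (Nat.mul_le_mul_right _
      (cliqueCount_le_card_isCompletePartite (G := G) (r := r) (t := 2 * D)))
    rw [hN]
    exact_mod_cast h1
  let F : (Fin r → Fin (2 * D) → V) → (Fin r × (Σ k : Fin (D + 1), Fin k → Fin r)) → ℝ :=
    fun Y p => if ∀ i, p.2.2 i ≠ p.1 then
      N ^ (2 * D) / N ^ (p.2.1 : ℕ) * momentSum G Y p.1 p.2.2 else 0
  have hF0 : ∀ Y p, 0 ≤ F Y p := by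
    intro Y p
    simp only [F]
    split_ifs
    · exact mul_nonneg (by positivity) (momentSum_nonneg _ _ _)
    · exact le_rfl
  have hFsum : ∀ p, ∑ Y ∈ 𝒴, F Y p ≤ N ^ (r * (2 * D)) := by
    intro p
    by_cases hp : ∀ i, p.2.2 i ≠ p.1
    · simp only [F, if_pos hp]
      rw [← mul_sum, div_mul_eq_mul_div, div_le_iff₀ (by positivity)]
      exact sum_momentSum_le p.1 p.2.2 hp
    · simp only [F, if_neg hp, sum_const_zero]
      positivity
  have hne : 𝒴.Nonempty := by
    by_contra hcon
    rw [not_nonempty_iff_eq_empty.1 hcon] at hcount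
    have : 0 < N ^ (r * (2 * D)) := by positivity
    simp only [card_empty, Nat.cast_zero, zero_mul] at hcount
    linarith
  obtain ⟨Y, hY, hYle⟩ : ∃ Y ∈ 𝒴, ∑ p, F Y p ≤ ρ ^ (2 * D) := by
    refine exists_le_of_sum_le hne ?_
    rw [sum_comm, sum_const, nsmul_eq_mul]
    calc ∑ p, ∑ Y ∈ 𝒴, F Y p
        ≤ ∑ p : Fin r × (Σ k : Fin (D + 1), Fin k → Fin r), N ^ (r * (2 * D)) :=
          sum_le_sum fun p _ => hFsum p
      _ = Fintype.card (Fin r × (Σ k : Fin (D + 1), Fin k → Fin r)) * N ^ (r * (2 * D)) := by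
          rw [sum_const, card_univ, nsmul_eq_mul]
      _ ≤ Fintype.card (Fin r × (Σ k : Fin (D + 1), Fin k → Fin r)) *
            (#𝒴 * 4 ^ (2 * (r * (2 * D)) * (r * (2 * D)))) := by gcongr
      _ = #𝒴 * (Fintype.card (Fin r × (Σ k : Fin (D + 1), Fin k → Fin r)) *
            4 ^ (2 * (r * (2 * D)) * (r * (2 * D)))) := by ring
      _ ≤ #𝒴 * ρ ^ (2 * D) := by
          gcongr
          exact card_patterns_le hr hD
  have hYc : IsCompletePartite G Y := (mem_filter.1 hY).2
  have hmom : ∀ (e : Fin r) (k : ℕ), k ≤ D → ∀ a : Fin k → Fin r, (∀ i, a i ≠ e) →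
      momentSum G Y e a ≤ ρ ^ (2 * D) * N ^ k / N ^ (2 * D) := by
    intro e k hk a ha
    have h1 := (single_le_sum (fun p _ => hF0 Y p)
      (mem_univ (e, (⟨⟨k, by omega⟩, a⟩ : Σ k : Fin (D + 1), Fin k → Fin r)))).trans hYle
    simp only [F] at h1
    rw [if_pos ha, div_mul_eq_mul_div, div_le_iff₀ (by positivity)] at h1
    rw [le_div_iff₀ (by positivity)]
    linarith
  have hmemY : ∀ e i, Y e i ∈ linkClass G Y e := by
    intro e i
    simp only [linkClass, mem_filter, mem_univ, true_and]
    exact fun b hb j => hYc b e hb j i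
  refine ⟨linkClass G Y, ⟨fun e => ?_, fun e K hK => ?_, fun e k hk a ha => ?_⟩⟩
  · have h1 := hmom e 0 (by omega) Fin.elim0 (fun i => i.elim0)
    have h2 : commonIn G (linkClass G Y e) ∅ = linkClass G Y e := by
      ext
      simp [mem_commonIn]
    have hpos : (0 : ℝ) < #(linkClass G Y e) := by
      exact_mod_cast card_pos.2 ⟨_, hmemY e ⟨0, by omega⟩⟩
    simp only [momentSum, univ_eq_empty, image_empty, h2, sum_const, nsmul_eq_mul,
      Fintype.card_piFinset, prod_empty, Nat.cast_one, one_mul, pow_zero, mul_one] at h1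
    rw [← div_pow] at h1
    have h3 := le_of_pow_le_pow_left₀ (by omega) (by positivity) h1
    rw [div_le_div_iff₀ hpos hN0, one_mul] at h3
    exact h3
  · refine ⟨Y e ⟨0, by omega⟩, mem_commonIn.2 ⟨hmemY e _, fun x hx => ?_⟩⟩
    obtain ⟨b, hb, hxb⟩ := hK x hx
    exact ((mem_filter.1 hxb).2 e hb.symm _).symm
  · have := hmom e k hk a ha
    unfold momentSum at this
    convert this using 5

end DependentRandomChoice

/-! ### Degenerate graphs and Ramsey numbers -/

section Degenerate

variable {W : Type u} {H : SimpleGraph W} {d : ℕ}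

open Classical in
theorem IsDegenerate.exists_card_le (hH : IsDegenerate H d) {S : Finset W} (hS : S.Nonempty) :
    ∃ v ∈ S, #{u ∈ S | H.Adj u v} ≤ d := by
  obtain ⟨v, hv, hle⟩ := hH ((⊤ : H.Subgraph).induce (S : Set W)) (by simpa using hS)
  have hv : v ∈ S := by simpa using hv
  refine ⟨v, hv, ?_⟩
  have heq : ((⊤ : H.Subgraph).induce (S : Set W)).neighborSet v
      = (({u ∈ S | H.Adj u v} : Finset W) : Set W) := by
    ext u
    simp [hv, H.adj_comm]
  rw [heq, Set.encard_coe_eq_coe_finsetCard] at hle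
  exact_mod_cast hle

open Classical in
theorem IsDegenerate.exists_order (hH : IsDegenerate H d) (S : Finset W) :
    ∃ f : W → ℕ, Set.InjOn f S ∧ (∀ v ∈ S, f v < #S) ∧
      ∀ v ∈ S, #{u ∈ S | H.Adj u v ∧ f u < f v} ≤ d := by
  induction hn : #S generalizing S with
  | zero =>
    obtain rfl := card_eq_zero.1 hn
    exact ⟨fun _ => 0, by simp, by simp, by simp⟩
  | succ n ih =>
    obtain ⟨v, hv, hdeg⟩ := hH.exists_card_le (card_pos.1 (by omega : 0 < #S))
    obtain ⟨f, hinj, hlt, hback⟩ := ih (S.erase v) (by rw [card_erase_of_mem hv]; omega)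
    have hne : ∀ {u}, u ∈ S → u ≠ v → u ∈ S.erase v := fun h1 h2 => mem_erase.2 ⟨h2, h1⟩
    refine ⟨Function.update f v n, ?_, ?_, ?_⟩
    · intro a ha b hb hab
      by_cases h1 : a = v <;> by_cases h2 : b = v
      · rw [h1, h2]
      · subst h1
        have := hlt b (hne hb h2)
        simp only [Function.update_self, Function.update_of_ne h2] at hab
        omega
      · subst h2
        have := hlt a (hne ha h1)
        simp only [Function.update_self, Function.update_of_ne h1] at hab
        omega
      · simp only [Function.update_of_ne h1, Function.update_of_ne h2] at hab
        exact hinj (hne ha h1) (hne hb h2) hab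
    · intro a ha
      by_cases h1 : a = v
      · simp [h1]
      · have := hlt a (hne ha h1)
        rw [Function.update_of_ne h1]
        omega
    · intro a ha
      by_cases h1 : a = v
      · subst h1
        refine (card_le_card fun u hu => ?_).trans hdeg
        obtain ⟨hu1, hu2, -⟩ := mem_filter.1 hu
        exact mem_filter.2 ⟨hu1, hu2⟩
      · refine (card_le_card fun u hu => ?_).trans (hback a (hne ha h1))
        obtain ⟨hu1, hu2, hu3⟩ := mem_filter.1 hu
        rw [Function.update_of_ne h1] at hu3
        have h2 : u ≠ v := by
          rintro rfl
          have := hlt a (hne ha h1)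
          rw [Function.update_self] at hu3
          omega
        rw [Function.update_of_ne h2] at hu3
        exact mem_filter.2 ⟨hne hu1 h2, hu2, hu3⟩

theorem IsDegenerate.colorable [Finite W] (hH : IsDegenerate H d) : H.Colorable (d + 1) := by
  classical
  have := Fintype.ofFinite W
  suffices h : ∀ S : Finset W, ∃ c : W → Fin (d + 1), ∀ u ∈ S, ∀ v ∈ S, H.Adj u v → c u ≠ c v by
    obtain ⟨c, hc⟩ := h univ
    exact ⟨SimpleGraph.Coloring.mk c fun {u v} huv => hc u (mem_univ _) v (mem_univ _) huv⟩
  intro S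
  induction hn : #S generalizing S with
  | zero =>
    obtain rfl := card_eq_zero.1 hn
    exact ⟨fun _ => 0, by simp⟩
  | succ n ih =>
    obtain ⟨v, hv, hdeg⟩ := hH.exists_card_le (card_pos.1 (by omega : 0 < #S))
    obtain ⟨c, hc⟩ := ih (S.erase v) (by rw [card_erase_of_mem hv]; omega)
    obtain ⟨k, -, hk⟩ : ∃ k ∈ (univ : Finset (Fin (d + 1))),
        k ∉ ({u ∈ S | H.Adj u v} : Finset W).image c := by
      refine exists_mem_notMem_of_card_lt_card ?_
      have := (card_image_le (s := ({u ∈ S | H.Adj u v} : Finset W)) (f := c)).trans hdeg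
      rw [card_univ, Fintype.card_fin]
      omega
    have hk' : ∀ u ∈ S, H.Adj u v → c u ≠ k := fun u hu huv heq =>
      hk (mem_image.2 ⟨u, mem_filter.2 ⟨hu, huv⟩, heq⟩)
    refine ⟨Function.update c v k, fun a ha b hb hab => ?_⟩
    by_cases h1 : a = v <;> by_cases h2 : b = v
    · exact absurd (h1.trans h2.symm) hab.ne
    · subst h1
      rw [Function.update_self, Function.update_of_ne h2]
      exact (hk' b hb hab.symm).symm
    · subst h2
      rw [Function.update_self, Function.update_of_ne h1]
      exact hk' a ha hab
    · rw [Function.update_of_ne h1, Function.update_of_ne h2]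
      exact hc a (mem_erase.2 ⟨h1, ha⟩) b (mem_erase.2 ⟨h2, hb⟩) hab

theorem IsDegenerate.eq_bot (hH : IsDegenerate H 0) : H = ⊥ := by
  classical
  rw [eq_bot_iff]
  intro u v huv
  obtain ⟨w, hw, hle⟩ := hH.exists_card_le (S := {u, v}) (by simp)
  have h0 := card_eq_zero.1 (Nat.le_zero.1 hle)
  rcases mem_insert.1 hw with rfl | hw
  · have : v ∈ ({x ∈ {w, v} | H.Adj x w} : Finset W) := by simp [huv.symm]
    simp [h0] at this
  · obtain rfl := mem_singleton.1 hw
    have : u ∈ ({x ∈ {u, w} | H.Adj x w} : Finset W) := by simp [huv]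
    simp [h0] at this

/-- The graph form of `IsRich.exists_embedding`. -/
theorem IsRich.isContained {V : Type v} [Fintype V] {G : SimpleGraph V} {r D : ℕ}
    {A : Fin r → Finset V} {ρ : ℝ} (h : IsRich G A D ρ) (hD : 2 ≤ D) {n : ℕ}
    (hn : 256 * ρ ^ 4 * n ≤ Fintype.card V) {s₀ : ℝ} (hs₀ : 0 < s₀)
    (hs₁ : s₀ ^ 2 * ρ ^ 4 ≤ 8 * Fintype.card V) (hs₂ : 2 * s₀ * ρ ^ 4 ≤ Fintype.card V)
    (hs₃ : r * ((Fintype.card V : ℝ) + 1) ^ D * Real.exp (-(s₀ / 4)) ≤ 1 / 4)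
    (hH : IsDegenerate H d) (hd : d ≤ D) [Finite W] (hW : Nat.card W ≤ n)
    (hcol : H.Colorable r) : H.IsContained G := by
  classical
  have := Fintype.ofFinite W
  rcases isEmpty_or_nonempty W with hE | hE
  · exact SimpleGraph.IsContained.of_isEmpty
  obtain ⟨f, hinj, hlt, hback⟩ := hH.exists_order univ
  have hinj : Function.Injective f := fun a b hab => hinj (by simp) (by simp) hab
  obtain ⟨col⟩ := hcol
  let g : ℕ → W := Function.invFun f
  have hg : ∀ w, g (f w) = w := Function.leftInverse_invFun hinj
  let B : ℕ → Finset ℕ := fun j =>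
    ({u | H.Adj u (g j) ∧ f u < f (g j) ∧ f (g j) = j} : Finset W).image f
  have hmemB : ∀ {j u}, u ∈ B j → ∃ w, H.Adj w (g j) ∧ f w < j ∧ f w = u := by
    intro j u hu
    obtain ⟨w, hw, rfl⟩ := mem_image.1 hu
    obtain ⟨-, h1, h2, h3⟩ := mem_filter.1 hw
    exact ⟨w, h1, h3 ▸ h2, rfl⟩
  obtain ⟨φ, hφ, hadj⟩ := h.exists_embedding (B := B) (χ := fun j => col (g j)) hD
    (fun j u hu => by
      obtain ⟨w, -, h2, rfl⟩ := hmemB hu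
      exact h2)
    (fun j => by
      refine card_image_le.trans ((card_le_card fun u hu => ?_).trans
        ((hback (g j) (mem_univ _)).trans hd))
      obtain ⟨-, h1, h2, -⟩ := mem_filter.1 hu
      exact mem_filter.2 ⟨mem_univ _, h1, h2⟩)
    (fun j u hu => by
      obtain ⟨w, h1, -, rfl⟩ := hmemB hu
      simp only [hg]
      exact col.valid h1)
    hn hs₀ hs₁ hs₂ (by rwa [Fintype.card_fin])
  have hfn : ∀ w, f w < n := fun w => by
    have := hlt w (mem_univ _)
    rw [card_univ, ← Nat.card_eq_fintype_card] at this
    omega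
  have hadj' : ∀ {a b}, H.Adj a b → f a < f b → G.Adj (φ (f a)) (φ (f b)) := by
    intro a b hab hlt
    refine hadj (f b) (hfn b) (f a) (mem_image.2 ⟨a, mem_filter.2 ⟨mem_univ _, ?_⟩, rfl⟩)
    rw [hg]
    exact ⟨hab, hlt, rfl⟩
  refine ⟨⟨⟨fun w => φ (f w), fun {a b} hab => ?_⟩, fun a b hab => ?_⟩⟩
  · rcases lt_trichotomy (f a) (f b) with hlt | heq | hlt
    · exact hadj' hab hlt
    · exact absurd (hinj heq) hab.ne
    · exact (hadj' hab.symm hlt).symm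
  · exact hinj (hφ (hfn a) (hfn b) hab)

end Degenerate

section Ramsey

theorem mul_pow_mul_exp_le {M ρ : ℝ} {r D : ℕ} (hρ : 1 ≤ ρ) (hρM : ρ ≤ M) (hr : r ≤ M)
    (hD : D ≤ M) (hD1 : 1 ≤ D) (hM : 76 ≤ M) :
    r * (M ^ 16 + 1) ^ D * Real.exp (-(M ^ 8 / ρ ^ 2 / 4)) ≤ 1 / 4 := by
  have hM0 : 0 < M := by linarith
  have h1 : M ^ 16 + 1 ≤ M ^ 17 := by
    have : 1 ≤ M ^ 16 := one_le_pow₀ (by linarith)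
    calc M ^ 16 + 1 ≤ 2 * M ^ 16 := by linarith
      _ ≤ M * M ^ 16 := by gcongr; linarith
      _ = M ^ 17 := by ring
  have h2 : 4 * (r * (M ^ 16 + 1) ^ D) ≤ Real.exp (19 * D * M) := by
    calc 4 * (r * (M ^ 16 + 1) ^ D) ≤ M * (M * (M ^ 17) ^ D) := by
          gcongr
          linarith
      _ = M ^ (2 + 17 * D) := by
          rw [← pow_mul]
          ring
      _ ≤ M ^ (19 * D) := pow_le_pow_right₀ (by linarith) (by omega)
      _ ≤ Real.exp M ^ (19 * D) := by
          gcongr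
          linarith [Real.add_one_le_exp M]
      _ = _ := by
          rw [← Real.exp_nat_mul]
          push_cast
          rfl
  have h3 : 19 * D * M ≤ M ^ 8 / ρ ^ 2 / 4 := by
    rw [div_div, le_div_iff₀ (by positivity)]
    calc 19 * D * M * (ρ ^ 2 * 4) = 76 * D * M * ρ ^ 2 := by ring
      _ ≤ M * M * M * M ^ 2 := by gcongr
      _ = M ^ 5 := by ring
      _ ≤ M ^ 8 := pow_le_pow_right₀ (by linarith) (by norm_num)
  rw [Real.exp_neg, ← div_eq_mul_inv, div_le_iff₀ (Real.exp_pos _)]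
  have := Real.exp_le_exp.2 h3
  linarith

/-- In every two-coloring of the edges of a complete graph on at least `2 ^ (320 * r ^ 2 * d) * n`
vertices, one of the color classes contains all `d`-degenerate `r`-colorable graphs on at most `n`
vertices. -/
theorem exists_isUniversal_labelGraph {d r n : ℕ} (hd : 1 ≤ d) (hr : 1 ≤ r) (hn : 1 ≤ n)
    {V : Type v} [Fintype V] (hV : 2 ^ (320 * r ^ 2 * d) * n ≤ Fintype.card V)
    (χ : SimpleGraph.TopEdgeLabeling V (Fin 2)) :
    ∃ k : Fin 2, IsUniversal.{u, v} (χ.labelGraph k) (DegenerateColorable d r n) := by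
  classical
  set D := 2 * d with hD
  set κ := 10 * r ^ 2 * D with hκ
  have hrD : 1 ≤ r * D := Nat.mul_pos hr (by omega)
  have hκr : 10 * (r * D) ≤ κ := by
    have : r * D ≤ r ^ 2 * D := Nat.mul_le_mul_right _ (Nat.le_self_pow (by norm_num) r)
    rw [hκ, mul_assoc]
    omega
  have hκ20 : 20 ≤ κ := by
    have : D ≤ r * D := Nat.le_mul_of_pos_left _ hr
    omega
  have hN : 2 ^ (16 * κ) * n ≤ Fintype.card V := by
    refine le_trans (le_of_eq ?_) hV
    rw [hκ, hD]
    ring_nf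
  have hN1 : 2 ^ (16 * κ) ≤ Fintype.card V := (Nat.le_mul_of_pos_right _ hn).trans hN
  have hNpos : 0 < Fintype.card V := lt_of_lt_of_le (by positivity) hN1
  have : Nonempty V := Fintype.card_pos_iff.1 hNpos
  obtain ⟨k, hk⟩ : ∃ k : Fin 2, Fintype.card V ^ (r * (2 * D)) ≤
      cliqueCount (χ.labelGraph k) (r * (2 * D)) univ
        * 4 ^ (2 * (r * (2 * D)) * (r * (2 * D))) := by
    have h1 := card_pow_le_cliqueCount (G := χ.labelGraph 0) (G' := χ.labelGraph 1)
      (fun x y hxy => ?_) (2 * (r * (2 * D))) (r * (2 * D)) (r * (2 * D)) (by ring) univ ?_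
    · rw [card_univ] at h1
      rcases h1 with h1 | h1
      · exact ⟨0, h1⟩
      · exact ⟨1, h1⟩
    · simp only [SimpleGraph.TopEdgeLabeling.labelGraph_adj]
      rcases Fin.exists_fin_two.1 ⟨χ.get x y hxy, rfl⟩ with h | h
      · exact Or.inl ⟨hxy, h⟩
      · exact Or.inr ⟨hxy, h⟩
    · rw [card_univ]
      refine le_trans ?_ hN1
      rw [show 4 = 2 ^ 2 from rfl, ← pow_mul]
      exact Nat.pow_le_pow_right (by norm_num) (by nlinarith)
  obtain ⟨A, hA⟩ := exists_isRich hr (by omega : 1 ≤ D) hk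
  rw [← hκ] at hA
  refine ⟨k, fun W H hH => ?_⟩
  obtain ⟨hfin, hcard, hdeg, hcol⟩ := hH
  -- In terms of the 16th root `M` of the number `N` of vertices, the threshold `s₀ = √N / ρ ^ 2` for
  -- the sizes of the candidate sets is at least `M ^ 6`.
  set M : ℝ := (Fintype.card V : ℝ) ^ ((16 : ℕ) : ℝ)⁻¹ with hM
  have hM16 : M ^ 16 = Fintype.card V := Real.rpow_inv_natCast_pow (by positivity) (by norm_num)
  have hM0 : 0 ≤ M := by positivity
  set ρ : ℝ := 2 ^ κ with hρ
  have hρ1 : 1 ≤ ρ := one_le_pow₀ (by norm_num)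
  have hρn : ρ ^ 16 * n ≤ Fintype.card V := by
    rw [hρ, ← pow_mul, mul_comm κ]
    exact_mod_cast hN
  have hρM : ρ ≤ M := by
    refine le_of_pow_le_pow_left₀ (n := 16) (by norm_num) hM0 ?_
    rw [hM16, hρ, ← pow_mul, mul_comm κ]
    exact_mod_cast hN1
  have hκM : (κ : ℝ) ≤ ρ := by
    rw [hρ]
    exact_mod_cast Nat.lt_two_pow_self.le
  have hρ20 : (2 : ℝ) ^ 20 ≤ ρ := pow_le_pow_right₀ (by norm_num) hκ20
  have hrκ : (r : ℝ) ≤ κ := by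
    have : r ≤ r * D := Nat.le_mul_of_pos_right _ (by omega)
    exact_mod_cast (by omega : r ≤ κ)
  have hDκ : (D : ℝ) ≤ κ := by
    have : D ≤ r * D := Nat.le_mul_of_pos_left _ hr
    exact_mod_cast (by omega : D ≤ κ)
  norm_num at hρ20
  refine hA.isContained (n := n) (s₀ := M ^ 8 / ρ ^ 2) (by omega) ?_ ?_ ?_ ?_ ?_ hdeg
    (by omega) hcard hcol
  · refine le_trans ?_ hρn
    gcongr
    calc 256 * ρ ^ 4 ≤ ρ * ρ ^ 4 := by gcongr; linarith
      _ = ρ ^ 5 := by ring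
      _ ≤ ρ ^ 16 := pow_le_pow_right₀ hρ1 (by norm_num)
  · have : 0 < M := by linarith
    positivity
  · rw [← hM16]
    have : (M ^ 8 / ρ ^ 2) ^ 2 * ρ ^ 4 = M ^ 16 := by field_simp
    rw [this]
    nlinarith [pow_nonneg hM0 16]
  · rw [← hM16]
    calc 2 * (M ^ 8 / ρ ^ 2) * ρ ^ 4 = 2 * ρ ^ 2 * M ^ 8 := by field_simp
      _ ≤ M * M ^ 2 * M ^ 8 := by
          gcongr
          linarith
      _ = M ^ 11 := by ring
      _ ≤ M ^ 16 := pow_le_pow_right₀ (by linarith) (by norm_num)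
  · rw [← hM16]
    exact mul_pow_mul_exp_le hρ1 hρM (by linarith) (by linarith) (by omega) (by linarith)

theorem exists_isUniversal_labelGraph_of_le (d r n : ℕ) (hn : 2 ^ (d ^ 2 * 2 ^ (12 * r)) ≤ n)
    {V : Type v} [Fintype V] (hV : 2 ^ (d * 2 ^ (12 * r)) * n ≤ Fintype.card V)
    (χ : SimpleGraph.TopEdgeLabeling V (Fin 2)) :
    ∃ k : Fin 2, IsUniversal.{u, v} (χ.labelGraph k) (DegenerateColorable d r n) := by
  have hn1 : 1 ≤ n := le_trans Nat.one_le_two_pow hn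
  rcases Nat.eq_zero_or_pos r with rfl | hr
  · refine ⟨0, fun W H hH => ?_⟩
    have : IsEmpty W := hH.2.2.2.isEmpty
    exact SimpleGraph.IsContained.of_isEmpty
  rcases Nat.eq_zero_or_pos d with rfl | hd
  · refine ⟨0, fun W H ⟨hfin, hcard, hdeg, hcol⟩ => ?_⟩
    have := Fintype.ofFinite W
    obtain rfl := hdeg.eq_bot
    refine SimpleGraph.bot_isContained_iff_card_le.2 ?_
    rw [Nat.card_eq_fintype_card] at hcard
    simp only [zero_mul, pow_zero, one_mul] at hV
    exact hcard.trans hV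
  refine exists_isUniversal_labelGraph hd hr hn1 (le_trans ?_ hV) χ
  refine Nat.mul_le_mul_right _ (Nat.pow_le_pow_right (by norm_num) ?_)
  rw [mul_comm]
  refine Nat.mul_le_mul_left _ ?_
  have h1 : r < 2 ^ r := Nat.lt_two_pow_self
  calc 320 * r ^ 2 ≤ (2 ^ 10) ^ r * (2 ^ r) ^ 2 := by
        refine Nat.mul_le_mul ?_ (Nat.pow_le_pow_left h1.le 2)
        calc 320 ≤ (2 ^ 10) ^ 1 := by norm_num
          _ ≤ (2 ^ 10) ^ r := Nat.pow_le_pow_right (by norm_num) hr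
    _ = 2 ^ (12 * r) := by
        rw [← pow_mul, ← pow_mul, ← pow_add]
        ring_nf

end Ramsey

end BurrErdos


theorem theorem1p1 :
    -- the main theorem
    (∃ c : ℕ, ∀ d r n : ℕ, 2 ^ (d ^ 2 * 2 ^ (c * r)) ≤ n →
      ∀ (V : Type v) [Fintype V], 2 ^ (d * 2 ^ (c * r)) * n ≤ Fintype.card V →
        ∀ χ : SimpleGraph.TopEdgeLabeling V (Fin 2),
          ∃ k : Fin 2, BurrErdos.IsUniversal.{u, v} (χ.labelGraph k)
            (BurrErdos.DegenerateColorable d r n)) ∧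
    -- `d`-degenerate graphs are `(d + 1)`-colorable
    (∀ (d : ℕ) (W : Type u) [Fintype W] (H : SimpleGraph W),
      BurrErdos.IsDegenerate H d → H.Colorable (d + 1)) ∧
    -- the Burr–Erdős conjecture
    (∀ d : ℕ, ∃ C : ℕ, ∀ (W : Type u) [Fintype W] (H : SimpleGraph W),
      BurrErdos.IsDegenerate H d →
        BurrErdos.ramseyNumber H ≤ ((C * Fintype.card W : ℕ) : ℕ∞)) := by
  refine ⟨⟨12, fun d r n hn V _ hV χ => BurrErdos.exists_isUniversal_labelGraph_of_le d r n hn hV χ⟩,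
    fun d W _ H hH => hH.colorable, fun d => ?_⟩
  refine ⟨2 ^ (d * 2 ^ (12 * (d + 1))) * 2 ^ (d ^ 2 * 2 ^ (12 * (d + 1))), fun W _ H hH => ?_⟩
  refine sInf_le ⟨_, rfl, fun χ => ?_⟩
  rcases isEmpty_or_nonempty W with hE | hE
  · exact ⟨0, SimpleGraph.IsContained.of_isEmpty⟩
  have hW : 0 < Fintype.card W := Fintype.card_pos
  -- Small graphs count as graphs on at most `n` vertices for a multiple `n` of their order.
  obtain ⟨k, hk⟩ := BurrErdos.exists_isUniversal_labelGraph_of_le d (d + 1)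
    (2 ^ (d ^ 2 * 2 ^ (12 * (d + 1))) * Fintype.card W) (Nat.le_mul_of_pos_right _ hW)
    (by rw [Fintype.card_fin, mul_assoc]) χ
  refine ⟨k, hk W H ⟨inferInstance, ?_, hH, hH.colorable⟩⟩
  rw [Nat.card_eq_fintype_card]
  exact Nat.le_mul_of_pos_left _ (by positivity)
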